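/- **Setting.** Let $V$ be a finite set. An *input* consists of a directed graph $G=(V,E)$, a lazy estimate $\hat w$ with $\hat w(e)\in(0,\infty)$ for every $e\in E$, and vertices $v_{\rm source}\neq v_{\rm target}$, such that no two distinct simple paths from $v_{\rm source}$ to the same vertex have the same $\hat w$-cost. A *shortest-path problem* is an input together with a weight function $w$ such that, for every $e\in E$, $w(e)=\hat w(e)$ ($e$ is collision-free) or $w(e)=\infty$ ($e$ is in collision). The cost of a path is the sum of the weights of its edges; a shortest path (to a vertex) is a path from $v_{\rm source}$ of minimal and finite $w$-cost. **Algorithms.** A (deterministic) algorithm is given the input, and learns about $w$ only by evaluating (testing) edges $e$ one at a time, each evaluation returning $w(e)$; eventually it may report a path or failure. It belongs to the family $\mathcal{SP}$ if its state determines a tree $\mathcal T$ such that on every shortest-path problem: at every time $\mathcal T$ is a shortest-path tree rooted at $v_{\rm source}$ (for each vertex $u$ of $\mathcal T$, the path in $\mathcal T$ from $v_{\rm source}$ to $u$ is a shortest path with respect to $w$); an edge $(u,v)\in E$ is evaluated only when $u\in\mathcal T$, and only edges of $E$ are evaluated; and the algorithm terminates, reporting a shortest path from $v_{\rm source}$ to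 $v_{\rm target}$ if a collision-free path exists and failure otherwise. An algorithm is *edge-optimal* if it belongs to $\mathcal{SP}$ and, on every shortest-path problem, it tests no more edges than any other algorithm in $\mathcal{SP}$ (counting distinct edges, and likewise counting evaluations). **LRA\* with lookahead $\alpha\in\mathbb N\cup\{\infty\}$.** It maintains a lazy search tree rooted at $v_{\rm source}$. The path to each node of this tree consists of an evaluated collision-free part (head) of cost $c$ followed by an unevaluated part (tail) of $\hat w$-cost $\ell$ with $b\le\alpha$ edges. The tree is grown, in order of increasing key $c+\ell$ and without extending the target node, until every leaf that can be extended has $b=\alpha$; frontier nodes are the nodes with $b=\alpha$, and the target node once it is reached. In each iteration the frontier node of minimal key is taken and the first edge $(u,v)$ of its tail is evaluated. If it is collision-free, $v$ and its descendants are updated, and the path to $v_{\rm target}$ in the tree is reported if $v=v_{\rm target}$; if it is in collision, it is removed from the graph and the subtree of $v$ is rewired to best parents. Then the tree is extended again. If no frontier node is left, failure is reported. **LazySP** (with the forward edge selector) repeatedly takes a shortest path from $v_{\rm source}$ to $v_{\rm target}$ for the weights that equal $w$ on evaluated edges and $\hat w$ on unevaluated ones; it reports failure if there is none of finite cost, evaluates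 the first unevaluated edge of the path if there is one, and otherwise reports the path. **Theorem.** LRA\* with $\alpha=\infty$ is edge-optimal. Consequently LazySP with the forward edge selector is edge-optimal. -/

import Mathlib

open scoped ENNReal NNReal

universe u

namespace LazySearch

/-! ### Graphs, paths, costs -/

/-- `P = (v₁, …, v_k)` is a path from `a` to `b` along the directed edges in `E`. -/
def IsPath {V : Type u} (E : Finset (V × V)) (a b : V) (P : List V) : Prop :=
  P.IsChain (fun x y => (x, y) ∈ E) ∧ P.head? = some a ∧ P.getLast? = some b

/-- The edges of a path, in the order in which the path traverses them. -/
def pathEdges {V : Type u} (P : List V) : List (V × V) := P.zip P.tail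

/-- The cost of a path: the sum of the weights of its edges. -/
noncomputable def cost {V : Type u} (w : V × V → ℝ≥0∞) (P : List V) : ℝ≥0∞ :=
  ((pathEdges P).map w).sum

/-- What an algorithm is given: a directed graph, a positive lazy estimate of the edge weights, a
source and a target. No two distinct simple paths from the source to the same vertex have the same
lazy cost. -/
structure Input (V : Type u) where
  edges : Finset (V × V)
  lazyW : V × V → ℝ≥0
  source : V
  target : V
  lazyW_pos : ∀ e ∈ edges, 0 < lazyW e
  source_ne_target : source ≠ target
  no_ties : ∀ (v : V) (P Q : List V), IsPath edges source v P → IsPath edges source v Q →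
    P.Nodup → Q.Nodup →
    cost (fun e => (lazyW e : ℝ≥0∞)) P = cost (fun e => (lazyW e : ℝ≥0∞)) Q → P = Q

/-- `w` is a true weight function with lazy estimate `I.lazyW`: collision-free edges have weight
`I.lazyW e`, edges in collision have weight `∞`. A shortest-path problem is an `Input` together
with such a `w`. -/
def IsWeight {V : Type u} (I : Input V) (w : V × V → ℝ≥0∞) : Prop :=
  ∀ e ∈ I.edges, w e = (I.lazyW e : ℝ≥0∞) ∨ w e = ∞

/-- `P` is a path of minimal cost from the source to `v`, and this cost is finite. -/
def IsShortestPath {V : Type u} (I : Input V) (w : V × V → ℝ≥0∞) (v : V) (P : List V) : Prop :=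
  IsPath I.edges I.source v P ∧ cost w P < ∞ ∧
    ∀ Q, IsPath I.edges I.source v Q → cost w P ≤ cost w Q

/-! ### Algorithms that access the true weights by evaluating edges -/

/-- An algorithm either evaluates an edge or terminates with a path or with failure (`none`). -/
inductive Action (V : Type u) where
  | eval (e : V × V)
  | report (r : Option (List V))

/-- An algorithm. It depends on the true weight function only through the values that it obtains
by evaluating edges. -/
structure Algorithm (V : Type u) where
  State : Type u
  init : Input V → State
  action : Input V → State → Action V
  next : Input V → State → ℝ≥0∞ → State

namespace Algorithm

variable {V : Type u} (A : Algorithm V) (I : Input V) (w : V × V → ℝ≥0∞)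

/-- One step of the execution; a state in which the algorithm has terminated is kept. -/
def step (σ : A.State) : A.State :=
  match A.action I σ with
  | .eval e => A.next I σ (w e)
  | .report _ => σ

/-- The state after `n` steps of the execution on the problem `(I, w)`. -/
def stateAt (n : ℕ) : A.State := (A.step I w)^[n] (A.init I)

/-- The set of edges that the algorithm tests on the problem `(I, w)`. -/
def testedEdges : Set (V × V) := {e | ∃ n, A.action I (A.stateAt I w n) = .eval e}

/-- The set of times at which the algorithm evaluates an edge. -/
def evalTimes : Set ℕ := {n | ∃ e, A.action I (A.stateAt I w n) = .eval e}

end Algorithm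

/-! ### The family of algorithms that build a shortest-path tree; edge-optimality -/

/-- A set of vertices with parent pointers. -/
structure Tree (V : Type u) where
  verts : Set V
  parent : V → Option V

/-- `T` is a shortest-path tree rooted at the source for the true weights `w`: following the parent
pointers backwards from any of its vertices, one stays in `T` and traverses a shortest
collision-free path from the source to that vertex. -/
def IsShortestPathTree {V : Type u} (I : Input V) (w : V × V → ℝ≥0∞) (T : Tree V) : Prop :=
  I.source ∈ T.verts ∧ T.parent I.source = none ∧
    ∀ v ∈ T.verts, ∃ P, IsShortestPath I w v P ∧ (∀ x ∈ P, x ∈ T.verts) ∧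
      P.IsChain (fun a b => T.parent b = some a)

/-- The family of shortest-path algorithms that build a shortest-path tree: the state determines a
tree such that, on every problem, it is at every time a shortest-path tree rooted at the source,
only edges `(u, v)` of the graph with `u` in the current tree are evaluated, and the algorithm
terminates with a shortest path from the source to the target, or with failure if there is no
collision-free path. -/
def InSP {V : Type u} (A : Algorithm V) : Prop :=
  ∃ T : Input V → A.State → Tree V, ∀ (I : Input V) (w : V × V → ℝ≥0∞), IsWeight I w →
    (∀ n, IsShortestPathTree I w (T I (A.stateAt I w n))) ∧
    (∀ n e, A.action I (A.stateAt I w n) = .eval e →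
      e ∈ I.edges ∧ e.1 ∈ (T I (A.stateAt I w n)).verts) ∧
    (∃ n r, A.action I (A.stateAt I w n) = .report r) ∧
    (∀ n P, A.action I (A.stateAt I w n) = .report (some P) → IsShortestPath I w I.target P) ∧
    (∀ n, A.action I (A.stateAt I w n) = .report none → ¬ ∃ P, IsShortestPath I w I.target P)

/-- An algorithm of the family is edge-optimal if on every problem it tests no more edges than any
algorithm of the family, both when distinct edges and when calls of the weight function are
counted. -/
def EdgeOptimal {V : Type u} (A : Algorithm V) : Prop :=
  InSP A ∧ ∀ B : Algorithm V, InSP B → ∀ (I : Input V) (w : V × V → ℝ≥0∞), IsWeight I w →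
    (A.testedEdges I w).encard ≤ (B.testedEdges I w).encard ∧
    (A.evalTimes I w).encard ≤ (B.evalTimes I w).encard

/-! ### LazySP with the forward edge selector -/

/-- The weights that LazySP searches with: the true weight of an evaluated edge, the lazy estimate
of an unevaluated one. -/
noncomputable def currentWeight {V : Type u} (I : Input V) (known : V × V → Option ℝ≥0∞)
    (e : V × V) : ℝ≥0∞ :=
  (known e).getD (I.lazyW e)

open Classical in
/-- LazySP: the state records the values of the evaluated edges. Take a shortest path to the target
for the current weights; report failure if there is none, evaluate its first unevaluated edge if
there is one, and report the path otherwise. -/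
noncomputable def lazySPAction {V : Type u} (I : Input V) (known : V × V → Option ℝ≥0∞) :
    Action V :=
  if h : ∃ P, IsShortestPath I (currentWeight I known) I.target P then
    match (pathEdges h.choose).find? (fun e => (known e).isNone) with
    | some e => .eval e
    | none => .report (some h.choose)
  else .report none

noncomputable def lazySP (V : Type u) [DecidableEq V] : Algorithm V where
  State := V × V → Option ℝ≥0∞
  init _ := fun _ => none
  action := lazySPAction
  next I known x :=
    match lazySPAction I known with
    | .eval e => Function.update known e (some x)
    | .report _ => known

/-! ### Lazy Receding-Horizon A* -/

/-- The result of `while cond do body` (the initial value if the loop does not terminate). -/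
noncomputable def whileLoop {σ : Type u} (cond : σ → Prop) (body : σ → σ) (s : σ) : σ :=
  open Classical in
  if h : ∃ n, ¬ cond (body^[n] s) then body^[Nat.find h] s else s

/-- The entry of the node of a vertex: its parent, the cost `c` of the evaluated part and the lazy
cost `l` of the unevaluated part of its path, and its budget `b`, the number of unevaluated edges
of that path. -/
structure Entry (V : Type u) where
  parent : Option V
  c : ℝ≥0∞
  l : ℝ≥0∞
  b : ℕ∞

/-- The key by which all queues are ordered. -/
noncomputable def Entry.key {V : Type u} (t : Entry V) : ℝ≥0∞ := t.c + t.l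

/-- The entry `(NIL, ∞, ∞, ∞)`. -/
def Entry.unset {V : Type u} : Entry V := ⟨none, ∞, ∞, ⊤⟩

/-- The data of LRA*: the edges not yet found to be in collision, the node entries, the vertices
whose nodes are in the search tree, the four queues, and the subtree that is to be rewired. -/
structure LRAState (V : Type u) where
  E : Finset (V × V)
  node : V → Entry V
  T : Finset V
  Qfrontier : Finset V
  Qextend : Finset V
  Qupdate : Finset V
  Qrewire : Finset V
  Trewire : Finset V
  result : Option (List V)

namespace LRAState

variable {V : Type u} [Fintype V] [DecidableEq V] (I : Input V) (α : ℕ∞)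

/-- An element of minimal key of a queue; ties are broken arbitrarily. -/
noncomputable def top (s : LRAState V) (Q : Finset V) : V :=
  if h : Q.Nonempty then (Q.exists_min_image (fun v => (s.node v).key) h).choose else I.source

open Classical in
/-- The subtree of the search tree rooted at the node of `v`. -/
noncomputable def subtree (s : LRAState V) (v : V) : Finset V :=
  s.T.filter fun x => Relation.ReflTransGen (fun a b => (s.node a).parent = some b) x v

/-- The path obtained by following parent pointers backwards from `v`, for at most `n` steps. -/
def backtrack (s : LRAState V) : ℕ → V → List V
  | 0, v => [v]
  | n + 1, v =>
    match (s.node v).parent with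
    | none => [v]
    | some p => backtrack s n p ++ [v]

/-- The path in the search tree from the source to `v`. A tree path has at most `|V|` vertices. -/
def pathTo (s : LRAState V) (v : V) : List V := s.backtrack (Fintype.card V) v

/-- The entry of the node of `v` when it gets the node of `p` as its parent through an unevaluated
edge. -/
noncomputable def childEntry (s : LRAState V) (p v : V) : Entry V :=
  ⟨some p, (s.node p).c, (s.node p).l + I.lazyW (p, v), (s.node p).b + 1⟩

noncomputable def setNode (s : LRAState V) (v : V) (t : Entry V) : LRAState V :=
  { s with node := Function.update s.node v t }

/-- The edge to be evaluated: the first edge of the unevaluated part of the path to the frontier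
node of minimal key. -/
noncomputable def nextEdge (s : LRAState V) : Option (V × V) :=
  (pathEdges (s.pathTo (s.top I s.Qfrontier))).find? fun e => decide ((s.node e.2).b ≠ 0)

/-! #### Extending the α-band -/

/-- The processing of one successor `v` of the node `p` that is being extended. -/
noncomputable def extendChild (p : V) (s : LRAState V) (v : V) : LRAState V :=
  if (s.childEntry I p v).key > (s.node v).key then s
  else
    let t := s.childEntry I p v
    let s₁ : LRAState V :=
      if v ∈ s.T then
        { s with
          T := s.T \ s.subtree v
          Qfrontier := s.Qfrontier \ s.subtree v
          Qextend := s.Qextend \ s.subtree v }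
      else s
    let s₂ : LRAState V := { s₁.setNode v t with T := insert v s₁.T }
    if t.b = α then { s₂ with Qfrontier := insert v s₂.Qfrontier }
    else { s₂ with Qextend := insert v s₂.Qextend }

noncomputable def extendBody (s : LRAState V) : LRAState V :=
  let p := s.top I s.Qextend
  let s₁ : LRAState V := { s with Qextend := s.Qextend.erase p }
  if p = I.target then { s₁ with Qfrontier := insert p s₁.Qfrontier }
  else (Finset.univ.filter fun v => (p, v) ∈ s₁.E).toList.foldl (extendChild I α p) s₁

noncomputable def extendBand : LRAState V → LRAState V :=
  whileLoop (fun s => s.Qextend.Nonempty) (extendBody I α)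

/-! #### Updating the α-band after a collision-free edge -/

noncomputable def updateChild (p : V) (s : LRAState V) (v : V) : LRAState V :=
  let s₁ : LRAState V :=
    if (s.node v).b = α then { s with Qfrontier := s.Qfrontier.erase v } else s
  { s₁.setNode v (s₁.childEntry I p v) with Qupdate := insert v s₁.Qupdate }

noncomputable def updateBody (s : LRAState V) : LRAState V :=
  let p := s.top I s.Qupdate
  let s₁ : LRAState V := { s with Qupdate := s.Qupdate.erase p }
  let succ := s₁.T.filter fun v => (s₁.node v).parent = some p
  if succ = ∅ then { s₁ with Qextend := insert p s₁.Qextend }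
  else succ.toList.foldl (updateChild I α p) s₁

noncomputable def updateBand : LRAState V → LRAState V :=
  whileLoop (fun s => s.Qupdate.Nonempty) (updateBody I α)

/-! #### Rewiring the α-band after an edge in collision -/

/-- Make the node of `p` the parent of the node of `v` if this strictly decreases its key. -/
noncomputable def relax (v : V) (s : LRAState V) (p : V) : LRAState V :=
  if (s.node v).key > (s.childEntry I p v).key then s.setNode v (s.childEntry I p v) else s

/-- Reset a node of the subtree to be rewired and attach it to its best valid parent. -/
noncomputable def rewireReset (s : LRAState V) (v : V) : LRAState V :=
  let s₁ : LRAState V :=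
    { s.setNode v Entry.unset with T := s.T.erase v, Qfrontier := s.Qfrontier.erase v }
  let parents := s₁.T.filter fun p => (p, v) ∈ s₁.E ∧ (s₁.node p).b < α ∧
    p ∉ s₁.Trewire ∧ p ∉ s₁.Qextend ∧ p ≠ I.target
  let s₂ := parents.toList.foldl (relax I v) s₁
  { s₂ with Qrewire := insert v s₂.Qrewire }

noncomputable def rewireBody (s : LRAState V) : LRAState V :=
  let p := s.top I s.Qrewire
  let s₁ : LRAState V := { s with Qrewire := s.Qrewire.erase p }
  if (s₁.node p).parent = none then s₁
  else
    let s₂ : LRAState V := { s₁ with T := insert p s₁.T }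
    if (s₂.node p).b = α ∨ p = I.target then { s₂ with Qfrontier := insert p s₂.Qfrontier }
    else
      let s₃ : LRAState V :=
        if (s₂.node p).b < α then { s₂ with Qextend := insert p s₂.Qextend } else s₂
      (s₃.Qrewire.filter fun v => (p, v) ∈ s₃.E).toList.foldl (fun s v => relax I v s p) s₃

noncomputable def rewireBand (s : LRAState V) : LRAState V :=
  let s₁ := s.Trewire.toList.foldl (rewireReset I α) s
  { whileLoop (fun s => s.Qrewire.Nonempty) (rewireBody I α) s₁ with Trewire := ∅ }

/-! #### The main algorithm -/

/-- The processing of the true weight `x` of the evaluated edge `e`. -/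
noncomputable def evaluate (s : LRAState V) (e : V × V) (x : ℝ≥0∞) : LRAState V :=
  if x = I.lazyW e then
    { s.setNode e.2 ⟨some e.1, (s.node e.1).c + x, 0, 0⟩ with Qupdate := insert e.2 s.Qupdate }
  else { s with E := s.E.erase e, Trewire := s.subtree e.2 }

/-- The state at the beginning of the main loop. -/
noncomputable def start : LRAState V :=
  extendBand I α
    { E := I.edges
      node := Function.update (fun _ => Entry.unset) I.source ⟨none, 0, 0, 0⟩
      T := {I.source}
      Qfrontier := ∅
      Qextend := {I.source}
      Qupdate := ∅
      Qrewire := ∅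
      Trewire := ∅
      result := none }

/-- One iteration of the main loop, in which the edge `nextEdge` was found to have weight `x`. -/
noncomputable def iteration (s : LRAState V) (x : ℝ≥0∞) : LRAState V :=
  match s.nextEdge I with
  | none => s
  | some e =>
    let s₁ : LRAState V := { s with Qfrontier := s.Qfrontier.erase (s.top I s.Qfrontier) }
    let s₂ := s₁.evaluate I e x
    if I.target ∈ s₂.Qupdate then { s₂ with result := some (s₂.pathTo I.target) }
    else extendBand I α (rewireBand I α (updateBand I α s₂))

/-- Return the path that was found, fail if no frontier node is left, and otherwise evaluate the
next edge. -/
noncomputable def act (s : LRAState V) : Action V :=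
  match s.result with
  | some P => .report (some P)
  | none =>
    if s.Qfrontier = ∅ then .report none
    else
      match s.nextEdge I with
      | some e => .eval e
      | none => .report none

end LRAState

/-- Lazy Receding-Horizon A* (LRA*) with lookahead `α`. -/
noncomputable def LRAstar (V : Type u) [Fintype V] [DecidableEq V] (α : ℕ∞) : Algorithm V where
  State := LRAState V
  init I := LRAState.start I α
  action I s := s.act I
  next I s x := s.iteration I α x

end LazySearch

set_option linter.unusedSectionVars false

namespace LazySearch

/-! ### Edges and costs of paths -/

section Paths

variable {V : Type u}

/-! Edge-optimality combines a lower bound valid for the whole family, which LazySP meets, with the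
fact that LRA* with infinite lookahead takes exactly the same actions as LazySP.

The lower bound (`InSP.mem_testedEdges`) is an adversary argument. Let `P` be the shortest path to
the target for some optimistic weights, and let `e` be an edge of `P` such that the edges of `P`
before it are collision-free. An algorithm that never tests `e` runs in the same way if `e` is put
in collision, and also if untested edges of `P` are made free. If it finds no collision on `P`, it
cannot tell a problem in which `P` must be reported from one in which `P` is blocked. Otherwise the
first collision `f` that it finds on `P` comes after `e`, and evaluating `f` needs the tail of `f`
in the tree; but the tree is a function of the state, and its path to that vertex would have to run
through `e` in one problem and avoid `e` in the other. LazySP tests only such edges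
(`lazySP_testedEdges_subset`) and none of them twice, so it is optimal for both counts.

For LRA*, the absence of ties gives each reachable vertex a unique shortest path and each reachable
vertex other than the source a unique predecessor (`Pred`). Between iterations the search tree is
the complete shortest-path tree (`Stable`) for `bandWeight`, that is, for the current weights of
LazySP with the edges leaving the target deleted, and the frontier contains at most the target. So
the tree path to the target is the path of LazySP, and both select the same edge
(`exists_nextEdge`).

It remains to preserve this invariant. A collision-free edge changes no distance; it only
redistributes keys between evaluated and unevaluated parts (`updateBody_spec`). A collision affects
only the subtree below the edge, which is rebuilt by Dijkstra's algorithm (`rewireBody_spec`,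
`extInv_rewireBand`). Extending the band is Dijkstra's algorithm as well (`extendBody_spec`); both
uses rest on `dijkstra_min`. `Related` couples the invariant with the records of LazySP, and
`Related.iteration` carries it through one evaluation. -/

@[simp] theorem pathEdges_nil : pathEdges ([] : List V) = [] := rfl

@[simp] theorem pathEdges_singleton (a : V) : pathEdges [a] = [] := rfl

@[simp] theorem pathEdges_cons_cons (a b : V) (l : List V) :
    pathEdges (a :: b :: l) = (a, b) :: pathEdges (b :: l) := rfl

theorem pathEdges_append_cons (A : List V) (x : V) (B : List V) :
    pathEdges (A ++ x :: B) = pathEdges (A ++ [x]) ++ pathEdges (x :: B) := by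
  induction A with
  | nil => simp
  | cons a A ih => cases A <;> simp_all

theorem cost_append_cons (w : V × V → ℝ≥0∞) (A : List V) (x : V) (B : List V) :
    cost w (A ++ x :: B) = cost w (A ++ [x]) + cost w (x :: B) := by
  simp [cost, pathEdges_append_cons A x B]

@[simp] theorem cost_singleton (w : V × V → ℝ≥0∞) (a : V) : cost w [a] = 0 := by simp [cost]

@[simp] theorem cost_cons_cons (w : V × V → ℝ≥0∞) (a b : V) (l : List V) :
    cost w (a :: b :: l) = w (a, b) + cost w (b :: l) := by simp [cost]

theorem cost_mono {w w' : V × V → ℝ≥0∞} {P : List V} (h : ∀ e ∈ pathEdges P, w e ≤ w' e) :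
    cost w P ≤ cost w' P :=
  List.sum_le_sum h

theorem cost_congr {w w' : V × V → ℝ≥0∞} {P : List V} (h : ∀ e ∈ pathEdges P, w e = w' e) :
    cost w P = cost w' P := by
  unfold cost
  rw [List.map_congr_left h]

theorem le_cost_of_mem {w : V × V → ℝ≥0∞} {P : List V} {e : V × V} (h : e ∈ pathEdges P) :
    w e ≤ cost w P :=
  List.single_le_sum (by simp) _ (List.mem_map_of_mem h)

theorem mem_edges_of_isChain {E : Finset (V × V)} {P : List V}
    (h : P.IsChain (fun x y => (x, y) ∈ E)) {e : V × V} (he : e ∈ pathEdges P) : e ∈ E := by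
  induction P with
  | nil => simp at he
  | cons a l ih =>
    cases l with
    | nil => simp at he
    | cons b l =>
      rw [List.isChain_cons_cons] at h
      rcases List.mem_cons.1 he with rfl | he
      · exact h.1
      · exact ih h.2 he

/-- Turns a position in the edge list into a split of the vertex list, to which `isPath_append_cons`
and `IsShortestPath.initialPart` apply. -/
theorem exists_append_of_mem_pathEdges {P : List V} {e : V × V} {L M : List (V × V)}
    (h : pathEdges P = L ++ e :: M) :
    ∃ A B, P = A ++ e.1 :: e.2 :: B ∧ pathEdges (A ++ [e.1]) = L := by
  induction P generalizing L with
  | nil => simp at h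
  | cons a l ih =>
    cases l with
    | nil => simp at h
    | cons b l =>
      cases L with
      | nil =>
        simp only [pathEdges_cons_cons, List.nil_append, List.cons.injEq] at h
        refine ⟨[], l, ?_, by simp⟩
        rw [← h.1]; rfl
      | cons f L =>
        simp only [pathEdges_cons_cons, List.cons_append, List.cons.injEq] at h
        obtain ⟨A, B, h₁, h₂⟩ := ih h.2
        refine ⟨a :: A, B, by simp [h₁], ?_⟩
        cases A with
        | nil => simp at h₁ h₂ ⊢; rw [← h₁.1, ← h.1, h₂]; simp
        | cons a' A =>
          simp at h₁ h₂ ⊢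
          rw [← h₁.1, ← h.1, ← h₂, h₁.1]; simp

theorem exists_split_of_find? {P : List V} {q : V × V → Bool} {e : V × V}
    (h : (pathEdges P).find? q = some e) :
    q e = true ∧ ∃ A B, P = A ++ e.1 :: e.2 :: B ∧ ∀ f ∈ pathEdges (A ++ [e.1]), q f = false := by
  obtain ⟨h₁, L, M, h₂, h₃⟩ := List.find?_eq_some_iff_append.1 h
  obtain ⟨A, B, h₄, rfl⟩ := exists_append_of_mem_pathEdges h₂
  exact ⟨h₁, A, B, h₄, fun f hf => by simpa using h₃ f hf⟩

theorem snd_mem_of_mem_pathEdges {P : List V} {e : V × V} (h : e ∈ pathEdges P) : e.2 ∈ P :=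
  List.mem_of_mem_tail (List.of_mem_zip h).2

/-! ### Paths -/

theorem IsPath.ne_nil {E : Finset (V × V)} {a b : V} {P : List V} (h : IsPath E a b P) :
    P ≠ [] := by
  rintro rfl; simp [IsPath] at h

theorem isPath_singleton (E : Finset (V × V)) (a : V) : IsPath E a a [a] := by simp [IsPath]

theorem isPath_append_cons {E : Finset (V × V)} {a b x : V} {A B : List V} :
    IsPath E a b (A ++ x :: B) ↔ IsPath E a x (A ++ [x]) ∧ IsPath E x b (x :: B) := by
  unfold IsPath
  rw [List.isChain_split]
  have : (A ++ x :: B).head? = (A ++ [x]).head? := by cases A <;> simp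
  simp only [this, List.getLast?_append_cons]
  simp; tauto

theorem IsPath.concat {E : Finset (V × V)} {a b c : V} {P : List V} (h : IsPath E a b P)
    (hbc : (b, c) ∈ E) : IsPath E a c (P ++ [c]) := by
  obtain ⟨h₁, h₂, h₃⟩ := h
  refine ⟨?_, by simp [h₂], by simp⟩
  rw [List.isChain_append]
  simp [h₁, h₃, hbc]

theorem IsPath.exists_concat {E : Finset (V × V)} {a b : V} {P : List V} (h : IsPath E a b P) :
    ∃ A, P = A ++ [b] := by
  obtain ⟨_, _, h₃⟩ := h
  exact List.getLast?_eq_some_iff.1 h₃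

theorem cost_concat {E : Finset (V × V)} {a b c : V} {P : List V} (h : IsPath E a b P)
    (w : V × V → ℝ≥0∞) : cost w (P ++ [c]) = cost w P + w (b, c) := by
  obtain ⟨A, rfl⟩ := h.exists_concat
  rw [List.append_assoc, List.singleton_append, cost_append_cons]
  simp

theorem exists_split_of_not_nodup {P : List V} (h : ¬ P.Nodup) :
    ∃ A x B C, P = A ++ x :: (B ++ x :: C) := by
  induction P with
  | nil => simp at h
  | cons a l ih =>
    by_cases ha : a ∈ l
    · obtain ⟨B, C, rfl⟩ := List.append_of_mem ha
      exact ⟨[], a, B, C, rfl⟩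
    · obtain ⟨A, x, B, C, rfl⟩ := ih (fun hl => h (List.nodup_cons.2 ⟨ha, hl⟩))
      exact ⟨a :: A, x, B, C, rfl⟩

theorem isPath_shortcut {E : Finset (V × V)} {a b x : V} {A B C : List V}
    (h : IsPath E a b (A ++ x :: (B ++ x :: C))) : IsPath E a b (A ++ x :: C) := by
  have h₁ := isPath_append_cons.1 h
  have h₂ : IsPath E x b ((x :: B) ++ x :: C) := h₁.2
  exact isPath_append_cons.2 ⟨h₁.1, (isPath_append_cons.1 h₂).2⟩

theorem cost_shortcut (w : V × V → ℝ≥0∞) (A : List V) (x : V) (B C : List V) :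
    cost w (A ++ x :: (B ++ x :: C)) = cost w (A ++ x :: C) + cost w (x :: (B ++ [x])) := by
  have h : cost w (x :: (B ++ x :: C)) = cost w (x :: (B ++ [x])) + cost w (x :: C) :=
    cost_append_cons w (x :: B) x C
  rw [cost_append_cons, h, cost_append_cons w A x C]
  ring

/-- Cycles are cut out one at a time. Simple paths are finitely many, which is why minima of the
cost exist. -/
theorem IsPath.exists_nodup {E : Finset (V × V)} {a b : V} {P : List V} (h : IsPath E a b P) :
    ∃ Q, IsPath E a b Q ∧ Q.Nodup ∧ ∀ w, cost w Q ≤ cost w P := by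
  induction hn : P.length using Nat.strong_induction_on generalizing P with
  | _ n ih =>
    by_cases hP : P.Nodup
    · exact ⟨P, h, hP, fun _ => le_rfl⟩
    · obtain ⟨A, x, B, C, rfl⟩ := exists_split_of_not_nodup hP
      obtain ⟨Q, h₁, h₂, h₃⟩ := ih _ (by rw [← hn]; simp) (isPath_shortcut h) rfl
      exact ⟨Q, h₁, h₂, fun w => (h₃ w).trans (by rw [cost_shortcut]; exact le_self_add)⟩

end Paths

/-! ### Shortest paths -/

section ShortestPaths

variable {V : Type u} {I : Input V} {ω : V × V → ℝ≥0∞}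

theorem IsWeight.lazyW_le (hω : IsWeight I ω) {e : V × V} (he : e ∈ I.edges) :
    (I.lazyW e : ℝ≥0∞) ≤ ω e := by
  rcases hω e he with h | h <;> simp [h]

theorem IsWeight.pos (hω : IsWeight I ω) {e : V × V} (he : e ∈ I.edges) : 0 < ω e :=
  lt_of_lt_of_le (by exact_mod_cast I.lazyW_pos e he) (hω.lazyW_le he)

theorem IsWeight.eq_lazyW (hω : IsWeight I ω) {e : V × V} (he : e ∈ I.edges) (h : ω e < ∞) :
    ω e = I.lazyW e :=
  (hω e he).resolve_right h.ne

theorem IsWeight.cost_eq_lazy (hω : IsWeight I ω) {a b : V} {P : List V}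
    (h : IsPath I.edges a b P) (hc : cost ω P < ∞) :
    cost ω P = cost (fun e => (I.lazyW e : ℝ≥0∞)) P :=
  cost_congr fun _ he => hω.eq_lazyW (mem_edges_of_isChain h.1 he) ((le_cost_of_mem he).trans_lt hc)

/-- A cycle has positive cost, so cutting it out would strictly lower a finite cost. -/
theorem IsShortestPath.nodup (hω : IsWeight I ω) {v : V} {P : List V}
    (h : IsShortestPath I ω v P) : P.Nodup := by
  by_contra hP
  obtain ⟨A, x, B, C, rfl⟩ := exists_split_of_not_nodup hP
  obtain ⟨h₁, h₂, h₃⟩ := h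
  have h₄ := h₃ _ (isPath_shortcut h₁)
  rw [cost_shortcut] at h₂ h₄
  have hp : 0 < cost ω (x :: (B ++ [x])) := by
    -- The first edge of the cycle is also an edge of the whole path, hence an edge of the graph
    -- with positive weight.
    obtain ⟨y, B', hB⟩ : ∃ y B', B ++ x :: C = y :: B' := by cases B <;> simp
    obtain ⟨y', B'', hB'⟩ : ∃ y B', B ++ [x] = y :: B' := by cases B <;> simp
    have hy : y = y' := by cases B <;> simp_all
    subst hy
    have h₅ := (isPath_append_cons.1 h₁).2.1
    rw [hB, List.isChain_cons_cons] at h₅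
    rw [hB', cost_cons_cons]
    exact lt_of_lt_of_le (hω.pos h₅.1) le_self_add
  have := ENNReal.lt_add_right (lt_of_le_of_lt le_self_add h₂).ne hp.ne'
  exact absurd h₄ (not_le.2 this)

/-- A finite true cost equals the lazy cost, so `no_ties` applies. This is its only use; everything
else relies on uniqueness of shortest paths. -/
theorem IsShortestPath.unique (hω : IsWeight I ω) {v : V} {P Q : List V}
    (hP : IsShortestPath I ω v P) (hQ : IsShortestPath I ω v Q) : P = Q := by
  refine I.no_ties v P Q hP.1 hQ.1 (hP.nodup hω) (hQ.nodup hω) ?_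
  rw [← hω.cost_eq_lazy hP.1 hP.2.1, ← hω.cost_eq_lazy hQ.1 hQ.2.1]
  exact le_antisymm (hP.2.2 _ hQ.1) (hQ.2.2 _ hP.1)

theorem IsShortestPath.initialPart {v x : V} {A B : List V}
    (h : IsShortestPath I ω v (A ++ x :: B)) : IsShortestPath I ω x (A ++ [x]) := by
  obtain ⟨h₁, h₂, h₃⟩ := h
  rw [cost_append_cons] at h₂
  obtain ⟨h₄, h₅⟩ := isPath_append_cons.1 h₁
  refine ⟨h₄, lt_of_le_of_lt le_self_add h₂, fun Q hQ => ?_⟩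
  obtain ⟨Q', rfl⟩ := hQ.exists_concat
  have h₆ := h₃ _ (isPath_append_cons.2 ⟨hQ, h₅⟩)
  rw [cost_append_cons, cost_append_cons ω Q'] at h₆
  exact (ENNReal.add_le_add_iff_right (lt_of_le_of_lt le_add_self h₂).ne).1 h₆

theorem exists_isShortestPath [Finite V] {v : V} {P : List V} (hP : IsPath I.edges I.source v P)
    (hc : cost ω P < ∞) : ∃ Q, IsShortestPath I ω v Q := by
  cases nonempty_fintype V
  have hfin : {Q : List V | IsPath I.edges I.source v Q ∧ Q.Nodup}.Finite :=
    (List.finite_length_le V (Fintype.card V)).subset fun Q hQ => hQ.2.length_le_card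
  obtain ⟨P', h₁, h₂, h₃⟩ := hP.exists_nodup
  obtain ⟨Q, hQ, hmin⟩ := Set.exists_min_image _ (cost ω) hfin ⟨P', h₁, h₂⟩
  refine ⟨Q, hQ.1, ((hmin P' ⟨h₁, h₂⟩).trans (h₃ ω)).trans_lt hc, fun R hR => ?_⟩
  obtain ⟨R', h₄, h₅, h₆⟩ := hR.exists_nodup
  exact (hmin R' ⟨h₄, h₅⟩).trans (h₆ ω)

/-- A shortest path stays one if the weights increase, but not on the path. -/
theorem IsShortestPath.mono {ω' : V × V → ℝ≥0∞} {v : V} {P : List V}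
    (h : IsShortestPath I ω v P) (hle : ∀ e ∈ I.edges, ω e ≤ ω' e)
    (heq : ∀ e ∈ pathEdges P, ω e = ω' e) : IsShortestPath I ω' v P := by
  obtain ⟨h₁, h₂, h₃⟩ := h
  rw [cost_congr heq] at h₂ h₃
  exact ⟨h₁, h₂, fun Q hQ =>
    (h₃ Q hQ).trans (cost_mono fun e he => hle e (mem_edges_of_isChain hQ.1 he))⟩

end ShortestPaths

/-! ### Distances and tight edges -/

section Dist

variable {V : Type u} (I : Input V) (ω : V × V → ℝ≥0∞)

/-- The distance from the source. -/
noncomputable def dist (v : V) : ℝ≥0∞ :=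
  ⨅ (P : List V) (_ : IsPath I.edges I.source v P), cost ω P

/-- `p` is the predecessor of `v` on the shortest path to `v`. -/
def Pred (p v : V) : Prop :=
  (p, v) ∈ I.edges ∧ dist I ω v = dist I ω p + ω (p, v) ∧ dist I ω v < ∞

variable {I ω}

theorem dist_le_cost {v : V} {P : List V} (h : IsPath I.edges I.source v P) :
    dist I ω v ≤ cost ω P :=
  iInf₂_le P h

theorem IsShortestPath.cost_eq {v : V} {P : List V} (h : IsShortestPath I ω v P) :
    cost ω P = dist I ω v :=
  le_antisymm (le_iInf₂ fun Q hQ => h.2.2 Q hQ) (dist_le_cost h.1)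

theorem isShortestPath_of_cost_le {v : V} {P : List V} (h : IsPath I.edges I.source v P)
    (hle : cost ω P ≤ dist I ω v) (hv : dist I ω v < ∞) : IsShortestPath I ω v P :=
  ⟨h, hle.trans_lt hv, fun _ hQ => hle.trans (dist_le_cost hQ)⟩

theorem exists_isShortestPath_of_dist_lt [Finite V] {v : V} (h : dist I ω v < ∞) :
    ∃ P, IsShortestPath I ω v P := by
  simp only [dist, iInf_lt_iff] at h
  obtain ⟨P, hP, hc⟩ := h
  exact exists_isShortestPath hP hc

theorem IsShortestPath.dist_lt {v : V} {P : List V} (h : IsShortestPath I ω v P) :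
    dist I ω v < ∞ := h.cost_eq ▸ h.2.1

@[simp] theorem dist_source : dist I ω I.source = 0 :=
  le_antisymm ((dist_le_cost (isPath_singleton _ _)).trans (by simp)) zero_le

theorem dist_mono {ω' : V × V → ℝ≥0∞} (hle : ∀ e ∈ I.edges, ω e ≤ ω' e) (v : V) :
    dist I ω v ≤ dist I ω' v :=
  le_iInf₂ fun _ hQ =>
    (dist_le_cost hQ).trans (cost_mono fun e he => hle e (mem_edges_of_isChain hQ.1 he))

theorem dist_le_add [Finite V] {p v : V} (h : (p, v) ∈ I.edges) :
    dist I ω v ≤ dist I ω p + ω (p, v) := by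
  by_cases hp : dist I ω p < ∞
  · obtain ⟨P, hP⟩ := exists_isShortestPath_of_dist_lt hp
    rw [← hP.cost_eq, ← cost_concat hP.1]
    exact dist_le_cost (hP.1.concat h)
  · rw [not_lt, top_le_iff] at hp
    simp [hp]

theorem Pred.dist_lt_top {p v : V} (h : Pred I ω p v) : dist I ω p < ∞ :=
  lt_of_le_of_lt (h.2.1 ▸ le_self_add) h.2.2

theorem Pred.weight_lt_top {p v : V} (h : Pred I ω p v) : ω (p, v) < ∞ :=
  lt_of_le_of_lt (h.2.1 ▸ le_add_self) h.2.2

theorem Pred.dist_lt (hω : IsWeight I ω) {p v : V} (h : Pred I ω p v) :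
    dist I ω p < dist I ω v := by
  rw [h.2.1]
  exact ENNReal.lt_add_right h.dist_lt_top.ne (hω.pos h.1).ne'

theorem not_pred_source (hω : IsWeight I ω) (p : V) : ¬ Pred I ω p I.source := fun h => by
  have := h.dist_lt hω
  simp at this

theorem Pred.concat {p v : V} {P : List V} (h : Pred I ω p v) (hP : IsShortestPath I ω p P) :
    IsShortestPath I ω v (P ++ [v]) :=
  isShortestPath_of_cost_le (hP.1.concat h.1)
    (by rw [cost_concat hP.1, hP.cost_eq, h.2.1]) h.2.2

/-- Appending `v` to the shortest paths to `p` and `q` gives two shortest paths to `v`, which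
coincide. -/
theorem Pred.unique [Finite V] (hω : IsWeight I ω) {p q v : V} (hp : Pred I ω p v)
    (hq : Pred I ω q v) : p = q := by
  obtain ⟨P, hP⟩ := exists_isShortestPath_of_dist_lt hp.dist_lt_top
  obtain ⟨Q, hQ⟩ := exists_isShortestPath_of_dist_lt hq.dist_lt_top
  have h := (hp.concat hP).unique hω (hq.concat hQ)
  have h' : P = Q := by simpa using h
  subst h'
  have := hP.1.2.2.symm.trans hQ.1.2.2
  simpa using this

theorem IsShortestPath.pred {p v x : V} {A B : List V}
    (h : IsShortestPath I ω x (A ++ p :: v :: B)) : Pred I ω p v := by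
  have hp := h.initialPart
  have hv : IsShortestPath I ω v ((A ++ [p]) ++ [v]) :=
    IsShortestPath.initialPart (x := v) (B := B) (A := A ++ [p]) (by simpa using h)
  refine ⟨mem_edges_of_isChain (P := A ++ p :: v :: B) h.1.1 ?_, ?_, hv.dist_lt⟩
  · rw [pathEdges_append_cons]; simp
  · rw [← hv.cost_eq, ← hp.cost_eq, cost_concat hp.1]

theorem IsShortestPath.isChain_pred {v : V} {P : List V} (h : IsShortestPath I ω v P) :
    P.IsChain (Pred I ω) := by
  rw [List.isChain_iff_forall_rel_of_append_cons_cons]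
  rintro a b A B rfl
  exact h.pred

/-- Induction along shortest paths. -/
theorem dist_induction [Finite V] {motive : V → Prop} (source : motive I.source)
    (step : ∀ p v, Pred I ω p v → motive p → motive v) {v : V} (hv : dist I ω v < ∞) :
    motive v := by
  obtain ⟨P, hP⟩ := exists_isShortestPath_of_dist_lt hv
  induction P using List.reverseRecOn generalizing v with
  | nil => exact absurd rfl hP.1.ne_nil
  | append_singleton A x ih =>
    have hx : x = v := by simpa [IsPath] using hP.1.2.2
    subst hx
    rcases List.eq_nil_or_concat A with rfl | ⟨A', p, rfl⟩
    · have : x = I.source := by simpa [IsPath] using hP.1.2.1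
      exact this ▸ source
    · have hP' : IsShortestPath I ω x (A' ++ p :: x :: []) := by simpa using hP
      exact step p x hP'.pred (ih hP'.pred.dist_lt_top (by simpa using hP'.initialPart))

theorem exists_pred [Finite V] {v : V} (hv : dist I ω v < ∞) (hs : v ≠ I.source) :
    ∃ p, Pred I ω p v :=
  dist_induction (motive := fun v => v ≠ I.source → ∃ p, Pred I ω p v) (fun h => absurd rfl h)
    (fun p _ h _ _ => ⟨p, h⟩) hv hs

theorem pred_of_le [Finite V] {p v : V} (h : (p, v) ∈ I.edges) (hp : dist I ω p < ∞)
    (hw : ω (p, v) < ∞) (hle : dist I ω p + ω (p, v) ≤ dist I ω v) : Pred I ω p v :=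
  ⟨h, le_antisymm (dist_le_add h) hle, (dist_le_add h).trans_lt (ENNReal.add_lt_top.2 ⟨hp, hw⟩)⟩

theorem dist_le_of_reflTransGen {p v : V} (h : Relation.ReflTransGen (Pred I ω) p v) :
    dist I ω p ≤ dist I ω v := by
  induction h with
  | refl => exact le_rfl
  | tail _ h ih => exact ih.trans (h.2.1 ▸ le_self_add)

theorem dist_lt_of_transGen (hω : IsWeight I ω) {p v : V}
    (h : Relation.TransGen (Pred I ω) p v) : dist I ω p < dist I ω v := by
  induction h with
  | single h => exact h.dist_lt hω
  | tail _ h ih => exact ih.trans (h.dist_lt hω)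

/-- `y` is the first vertex outside `S` on the shortest path to `q`. As predecessors are unique, the
ancestors of a vertex form a chain, and the alternative `key` can be carried along it. -/
theorem exists_first_unsettled [Finite V] (hω : IsWeight I ω) (S : Set V) {q : V}
    (hq : dist I ω q < ∞) (hqS : q ∉ S) :
    ∃ y, y ∉ S ∧ Relation.ReflTransGen (Pred I ω) y q ∧
      ∀ x, Relation.TransGen (Pred I ω) x y → x ∈ S := by
  have key : (∀ x, Relation.ReflTransGen (Pred I ω) x q → x ∈ S) ∨
      ∃ y, y ∉ S ∧ Relation.ReflTransGen (Pred I ω) y q ∧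
        ∀ x, Relation.TransGen (Pred I ω) x y → x ∈ S := by
    clear hqS
    refine dist_induction (motive := fun q => (∀ x, Relation.ReflTransGen (Pred I ω) x q → x ∈ S) ∨
      ∃ y, y ∉ S ∧ Relation.ReflTransGen (Pred I ω) y q ∧
        ∀ x, Relation.TransGen (Pred I ω) x y → x ∈ S) ?_ ?_ hq
    · have hsrc : ∀ x, ¬ Relation.TransGen (Pred I ω) x I.source := fun x hx => by
        have := dist_lt_of_transGen hω hx
        simp at this
      by_cases hs : I.source ∈ S
      · left
        intro x hx
        rcases Relation.reflTransGen_iff_eq_or_transGen.1 hx with rfl | hx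
        · exact hs
        · exact absurd hx (hsrc x)
      · exact Or.inr ⟨_, hs, .refl, fun x hx => absurd hx (hsrc x)⟩
    · rintro p v hpv (hl | ⟨y, h₁, h₂, h₃⟩)
      · have hanc : ∀ x, Relation.TransGen (Pred I ω) x v → x ∈ S := fun x hx => by
          obtain ⟨p', h, hp'⟩ := Relation.TransGen.tail'_iff.1 hx
          exact hl x (hp'.unique hω hpv ▸ h)
        by_cases hv : v ∈ S
        · left
          intro x hx
          rcases Relation.reflTransGen_iff_eq_or_transGen.1 hx with rfl | hx
          · exact hv
          · exact hanc x hx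
        · exact Or.inr ⟨v, hv, .refl, hanc⟩
      · exact Or.inr ⟨y, h₁, h₂.tail hpv, h₃⟩
  exact key.resolve_left fun h => hqS (h q .refl)

/-- The correctness of Dijkstra's algorithm: if the successors (in the shortest-path tree) of the
settled vertices `S` have entered the queue `Q` with their distance as key, then an element `p` of
minimal key has its distance as key, and its ancestors are settled. -/
theorem dijkstra_min [Finite V] (hω : IsWeight I ω) {S Q : Set V} {key : V → ℝ≥0∞} {p : V}
    (hs : I.source ∈ S ∨ I.source ∈ Q ∧ key I.source ≤ 0)
    (hS : ∀ x y, x ∈ S → Pred I ω x y → y ∉ S → y ∈ Q ∧ key y ≤ dist I ω y)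
    (hle : dist I ω p ≤ key p) (hmin : ∀ q ∈ Q, key p ≤ key q) (hp : p ∉ S)
    (hd : dist I ω p < ∞) :
    key p = dist I ω p ∧ ∀ q, Relation.TransGen (Pred I ω) q p → q ∈ S := by
  obtain ⟨y, h₁, h₂, h₃⟩ := exists_first_unsettled hω S hd hp
  have hy : key p ≤ dist I ω y := by
    by_cases hy : y = I.source
    · subst hy
      obtain ⟨h₄, h₅⟩ := hs.resolve_left h₁
      exact (hmin _ h₄).trans (h₅.trans (by simp))
    · obtain ⟨x, hx⟩ := exists_pred ((dist_le_of_reflTransGen h₂).trans_lt hd) hy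
      obtain ⟨h₄, h₅⟩ := hS x y (h₃ x (.single hx)) hx h₁
      exact (hmin _ h₄).trans h₅
  -- Now `key p ≤ dist y ≤ dist p ≤ key p`, and the middle inequality is strict if `y` is a proper
  -- ancestor of `p`.
  rcases Relation.reflTransGen_iff_eq_or_transGen.1 h₂ with rfl | h₂
  · exact ⟨le_antisymm hy hle, h₃⟩
  · exact absurd (hle.trans hy) (not_le.2 (dist_lt_of_transGen hω h₂))

end Dist

/-! ### The execution of an algorithm -/

namespace Algorithm

variable {V : Type u} {A : Algorithm V} {I : Input V} {w w' : V × V → ℝ≥0∞}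

theorem stateAt_succ (n : ℕ) : A.stateAt I w (n + 1) = A.step I w (A.stateAt I w n) :=
  Function.iterate_succ_apply' _ _ _

/-- The execution depends only on the weights of the tested edges. -/
theorem stateAt_congr (h : ∀ e ∈ A.testedEdges I w, w e = w' e) (n : ℕ) :
    A.stateAt I w n = A.stateAt I w' n := by
  induction n with
  | zero => rfl
  | succ n ih =>
    rw [stateAt_succ, stateAt_succ, ← ih]
    unfold step
    split
    · next e he => rw [h e ⟨n, he⟩]
    · rfl

/-- A competitor may evaluate an edge repeatedly; this turns a bound on its distinct edges into one
on its evaluations. -/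
theorem encard_testedEdges_le : (A.testedEdges I w).encard ≤ (A.evalTimes I w).encard := by
  have : Nonempty (V × V) := ⟨(I.source, I.source)⟩
  have hex : ∀ n ∈ A.evalTimes I w, ∃ e, A.action I (A.stateAt I w n) = .eval e := fun _ h => h
  choose! f hf using hex
  have hsub : A.testedEdges I w ⊆ f '' A.evalTimes I w := by
    rintro e ⟨n, hn⟩
    refine ⟨n, ⟨e, hn⟩, ?_⟩
    have := (hf n ⟨e, hn⟩).symm.trans hn
    simpa using this
  exact (Set.encard_le_encard hsub).trans (Set.encard_image_le _ _)

end Algorithm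

/-! ### Any algorithm of the family tests the edges of LazySP -/

section Lower

variable {V : Type u} {I : Input V} {w : V × V → ℝ≥0∞}

/-- Following parent pointers from a vertex leads to the root along a unique path. -/
theorem parent_chain_unique {π : V → Option V} {s : V} (hs : π s = none) {P Q : List V}
    (hP : P.IsChain (fun a b => π b = some a)) (hQ : Q.IsChain (fun a b => π b = some a))
    (hPs : P.head? = some s) (hQs : Q.head? = some s) (hl : P.getLast? = Q.getLast?) : P = Q := by
  induction P using List.reverseRecOn generalizing Q with
  | nil => simp at hPs
  | append_singleton A x ih =>
    rcases List.eq_nil_or_concat Q with rfl | ⟨B, y, rfl⟩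
    · simp at hQs
    simp only [List.concat_eq_append] at *
    obtain rfl : x = y := by simpa using hl
    rcases List.eq_nil_or_concat A with rfl | ⟨A', p, rfl⟩
    · obtain rfl : x = s := by simpa using hPs
      rcases List.eq_nil_or_concat B with rfl | ⟨B', q, rfl⟩
      · rfl
      · rw [List.isChain_append] at hQ
        simp [hs] at hQ
    · rcases List.eq_nil_or_concat B with rfl | ⟨B', q, rfl⟩
      · obtain rfl : x = s := by simpa using hQs
        rw [List.isChain_append] at hP
        simp [hs] at hP
      · simp only [List.concat_eq_append] at *
        rw [List.isChain_append] at hP hQ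
        have hpq : p = q := by
          have h₁ := hP.2.2 p (by simp) x (by simp)
          have h₂ := hQ.2.2 q (by simp) x (by simp)
          simpa [h₁] using h₂
        rw [ih hP.1 hQ.1 (by simpa using hPs) (by simpa using hQs) (by simp [hpq])]

theorem IsWeight.update_top [DecidableEq V] (hw : IsWeight I w) (e : V × V) :
    IsWeight I (Function.update w e ∞) := by
  intro f hf
  by_cases h : f = e
  · simp [h]
  · simpa [h] using hw f hf

open Classical in
/-- The weights that equal the lazy estimate on the edges of `P`. -/
noncomputable def freeAlong (I : Input V) (w : V × V → ℝ≥0∞) (P : List V) (e : V × V) : ℝ≥0∞ :=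
  if e ∈ pathEdges P then I.lazyW e else w e

theorem isWeight_freeAlong (hw : IsWeight I w) (P : List V) : IsWeight I (freeAlong I w P) := by
  intro e he
  unfold freeAlong
  split
  · exact Or.inl rfl
  · exact hw e he

/-- On `P` the finite weights `ω` are the lazy ones, and elsewhere `w` is at least `ω`; so the
weights only grow off the path. -/
theorem IsShortestPath.freeAlong {ω : V × V → ℝ≥0∞} (hω : IsWeight I ω)
    (hle : ∀ e ∈ I.edges, ω e ≤ w e) {v : V} {P : List V} (h : IsShortestPath I ω v P) :
    IsShortestPath I (freeAlong I w P) v P := by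
  have hfin : ∀ e ∈ pathEdges P, ω e = I.lazyW e := fun e he =>
    hω.eq_lazyW (mem_edges_of_isChain h.1.1 he) ((le_cost_of_mem he).trans_lt h.2.1)
  refine h.mono (fun e he => ?_) (fun e he => ?_)
  · unfold LazySearch.freeAlong
    split
    · next h' => rw [hfin e h']
    · exact hle e he
  · simp [LazySearch.freeAlong, he, hfin e he]

/-- Let `P` be a shortest path to the target for an optimistic estimate `ω` of the true weights,
and `e` an edge of `P` such that the edges of `P` before `e` are collision-free. Then every
algorithm of the family tests `e`. -/
theorem InSP.mem_testedEdges {B : Algorithm V} (hB : InSP B) (hw : IsWeight I w)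
    {ω : V × V → ℝ≥0∞} (hω : IsWeight I ω) (hle : ∀ e ∈ I.edges, ω e ≤ w e) {P : List V}
    (hP : IsShortestPath I ω I.target P) {e : V × V} {L M : List (V × V)}
    (hsplit : pathEdges P = L ++ e :: M) (hL : ∀ f ∈ L, w f < ∞) :
    e ∈ B.testedEdges I w := by
  classical
  by_contra hne
  obtain ⟨T, hT⟩ := hB
  -- First modified problem: since `e` is never tested, putting it in collision leaves the run
  -- unchanged.
  have hagree₂ : ∀ f ∈ B.testedEdges I w, w f = Function.update w e ∞ f := fun f hf => by
    rw [Function.update_of_ne]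
    rintro rfl
    exact hne hf
  have hst₂ := Algorithm.stateAt_congr hagree₂
  have hB₂ := hT I _ (hw.update_top e)
  have hcontra : ∀ {v R}, e ∈ pathEdges R → ¬ IsShortestPath I (Function.update w e ∞) v R := by
    intro v R he h
    have := (le_cost_of_mem (w := Function.update w e ∞) he).trans_lt h.2.1
    simp at this
  -- Second modified problem: making the edges of `R` free leaves the run unchanged, as long as none
  -- of them was found in collision.
  have hagree₁ : ∀ R : List V, (∀ f ∈ pathEdges R, ¬ (f ∈ B.testedEdges I w ∧ w f = ∞)) →
      (∀ f ∈ pathEdges R, f ∈ I.edges) →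
      ∀ f ∈ B.testedEdges I w, w f = freeAlong I w R f := by
    intro R hR hE f hf
    unfold freeAlong
    split
    · next h => exact hw.eq_lazyW (hE f h) (lt_top_iff_ne_top.2 fun h' => hR f h ⟨hf, h'⟩)
    · rfl
  cases hfind : (pathEdges P).find? (fun f => decide (f ∈ B.testedEdges I w ∧ w f = ∞)) with
  | none =>
    -- No collision was found on `P`. With `P` made free, the algorithm must report `P`, and the
    -- same run reports it when `e` is in collision.
    rw [List.find?_eq_none] at hfind
    have hag := hagree₁ P (fun f hf => by simpa using hfind f hf)
      (fun f hf => mem_edges_of_isChain hP.1.1 hf)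
    have hst₁ := Algorithm.stateAt_congr hag
    have hB₁ := hT I _ (isWeight_freeAlong hw P)
    have hP₁ := hP.freeAlong hω hle
    obtain ⟨n, r, hr⟩ := hB₁.2.2.1
    cases r with
    | none => exact hB₁.2.2.2.2 n hr ⟨P, hP₁⟩
    | some Q =>
      obtain rfl := (hB₁.2.2.2.1 n Q hr).unique (isWeight_freeAlong hw P) hP₁
      rw [← hst₁, hst₂] at hr
      exact hcontra (by rw [hsplit]; simp) (hB₂.2.2.2.1 n Q hr)
  | some f =>
    obtain ⟨hf, L', M', hsplit', hL'⟩ := List.find?_eq_some_iff_append.1 hfind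
    simp only [decide_eq_true_eq] at hf
    obtain ⟨R, S, hPR, hR⟩ := exists_append_of_mem_pathEdges hsplit'
    -- `f` comes after `e`: it is tested, so it is not `e`, and it is in collision, so it is not
    -- among the edges before `e`.
    have heR : e ∈ pathEdges (R ++ [f.1]) := by
      rw [hR]
      rcases List.append_eq_append_iff.1 (hsplit.symm.trans hsplit') with
        ⟨a, h₁, h₂⟩ | ⟨a, h₁, h₂⟩
      · cases a with
        | nil => simp at h₂; exact absurd (h₂.1 ▸ hf.1) hne
        | cons x a => simp at h₂; simp [h₁, h₂.1]
      · cases a with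
        | nil => simp at h₂; exact absurd (h₂.1 ▸ hf.1) hne
        | cons x a =>
          simp at h₂
          exact absurd hf.2 (hL f (by simp [h₁, h₂.1])).ne
    have hPR' : IsShortestPath I ω f.1 (R ++ [f.1]) := by
      rw [hPR] at hP; exact hP.initialPart
    have hag := hagree₁ (R ++ [f.1])
      (fun g hg => by simpa only [Bool.not_eq_true', decide_eq_false_iff_not] using hL' g (hR ▸ hg))
      (fun g hg => mem_edges_of_isChain hPR'.1.1 hg)
    have hst₁ := Algorithm.stateAt_congr hag
    have hB₁ := hT I _ (isWeight_freeAlong hw (R ++ [f.1]))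
    have hP₁ := hPR'.freeAlong hω hle
    obtain ⟨n, hn⟩ := hf.1
    have hn₁ := hn
    rw [hst₁] at hn₁
    -- The tail of `f` is in the tree when `f` is evaluated. Both modified problems have the same
    -- state, hence the same tree, whose path to this vertex must be the initial part of `P`; that
    -- part contains `e`.
    have hv := (hB₁.2.1 n f hn₁).2
    have hT₁ := hB₁.1 n
    have hT₂ := hB₂.1 n
    obtain ⟨Q₁, hQ₁, -, hc₁⟩ := hT₁.2.2 _ hv
    rw [← hst₁] at hv hc₁ hT₁
    rw [← hst₂] at hT₂
    obtain ⟨Q₂, hQ₂, -, hc₂⟩ := hT₂.2.2 _ hv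
    obtain rfl := hQ₁.unique (isWeight_freeAlong hw _) hP₁
    obtain rfl := parent_chain_unique hT₁.2.1 hc₁ hc₂ hQ₁.1.2.1 hQ₂.1.2.1
      (hQ₁.1.2.2.trans hQ₂.1.2.2.symm)
    exact hcontra heR hQ₂

end Lower

/-! ### LazySP -/

section LazySP

variable {V : Type u} {I : Input V} {w : V × V → ℝ≥0∞} {known : V × V → Option ℝ≥0∞}

/-- The recorded values are true weights of edges of the graph. -/
def Agrees (I : Input V) (w : V × V → ℝ≥0∞) (known : V × V → Option ℝ≥0∞) : Prop :=
  ∀ e y, known e = some y → e ∈ I.edges ∧ y = w e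

theorem Agrees.currentWeight_eq (h : Agrees I w known) {e : V × V} (he : known e ≠ none) :
    currentWeight I known e = w e := by
  obtain ⟨y, hy⟩ := Option.ne_none_iff_exists'.1 he
  simp [currentWeight, hy, (h e y hy).2]

theorem Agrees.isWeight (h : Agrees I w known) (hw : IsWeight I w) :
    IsWeight I (currentWeight I known) := by
  intro e he
  by_cases hk : known e = none
  · simp [currentWeight, hk]
  · rw [h.currentWeight_eq hk]; exact hw e he

theorem Agrees.currentWeight_le (h : Agrees I w known) (hw : IsWeight I w) {e : V × V}
    (he : e ∈ I.edges) : currentWeight I known e ≤ w e := by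
  by_cases hk : known e = none
  · simpa [currentWeight, hk] using hw.lazyW_le he
  · rw [h.currentWeight_eq hk]

theorem Agrees.isShortestPath (h : Agrees I w known) (hw : IsWeight I w) {v : V} {P : List V}
    (hP : IsShortestPath I (currentWeight I known) v P) (hk : ∀ e ∈ pathEdges P, known e ≠ none) :
    IsShortestPath I w v P :=
  hP.mono (fun _ he => h.currentWeight_le hw he) fun e he => h.currentWeight_eq (hk e he)

theorem Agrees.update [DecidableEq V] (h : Agrees I w known) {e : V × V} (he : e ∈ I.edges) :
    Agrees I w (Function.update known e (some (w e))) := by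
  intro f y hf
  by_cases hfe : f = e
  · subst hfe
    simp at hf
    exact ⟨he, hf.symm⟩
  · rw [Function.update_of_ne hfe] at hf
    exact h f y hf

/-- By uniqueness the arbitrarily chosen path is `P`, so the action can be computed from any known
shortest path. -/
theorem lazySPAction_of_isShortestPath (hk : IsWeight I (currentWeight I known)) {P : List V}
    (hP : IsShortestPath I (currentWeight I known) I.target P) :
    lazySPAction I known = match (pathEdges P).find? (fun e => (known e).isNone) with
      | some e => .eval e
      | none => .report (some P) := by
  have h : ∃ P, IsShortestPath I (currentWeight I known) I.target P := ⟨P, hP⟩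
  have hc : h.choose = P := h.choose_spec.unique hk hP
  rw [lazySPAction, dif_pos h]
  simp only [hc]

theorem lazySPAction_eq_eval {e : V × V} (h : lazySPAction I known = .eval e) :
    ∃ P, IsShortestPath I (currentWeight I known) I.target P ∧
      (pathEdges P).find? (fun e => (known e).isNone) = some e := by
  unfold lazySPAction at h
  split at h
  · next hex =>
    refine ⟨hex.choose, hex.choose_spec, ?_⟩
    split at h
    · next heq => rw [heq]; simpa using h
    · simp at h
  · simp at h

theorem lazySPAction_eq_report_some {P : List V} (h : lazySPAction I known = .report (some P)) :
    IsShortestPath I (currentWeight I known) I.target P ∧ ∀ e ∈ pathEdges P, known e ≠ none := by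
  unfold lazySPAction at h
  split at h
  · next hex =>
    split at h
    · simp at h
    · next heq =>
      simp only [Action.report.injEq, Option.some.injEq] at h
      subst h
      refine ⟨hex.choose_spec, fun e he => ?_⟩
      rw [List.find?_eq_none] at heq
      simpa using heq e he
  · simp at h

theorem lazySPAction_eq_report_none (h : lazySPAction I known = .report none) :
    ¬ ∃ P, IsShortestPath I (currentWeight I known) I.target P := by
  unfold lazySPAction at h
  split at h
  · split at h <;> simp at h
  · assumption

theorem lazySPAction_of_not_exists
    (h : ¬ ∃ P, IsShortestPath I (currentWeight I known) I.target P) :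
    lazySPAction I known = .report none := dif_neg h

theorem lazySPAction_eq_eval_edge {e : V × V} (h : lazySPAction I known = .eval e) :
    e ∈ I.edges ∧ known e = none := by
  obtain ⟨P, hP, hf⟩ := lazySPAction_eq_eval h
  exact ⟨mem_edges_of_isChain hP.1.1 (List.mem_of_find?_eq_some hf),
    by simpa using List.find?_some hf⟩

open Classical in
/-- The tree of the vertices to which all edges of the current shortest path have been evaluated. -/
noncomputable def lazySPTree (I : Input V) (known : V × V → Option ℝ≥0∞) : Tree V where
  verts := {v | ∃ P, IsShortestPath I (currentWeight I known) v P ∧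
    ∀ e ∈ pathEdges P, known e ≠ none}
  parent v := if h : ∃ p, Pred I (currentWeight I known) p v then some h.choose else none

theorem isShortestPath_source {ω : V × V → ℝ≥0∞} : IsShortestPath I ω I.source [I.source] :=
  ⟨isPath_singleton _ _, by simp, by simp⟩

theorem isShortestPathTree_lazySPTree [Finite V] (h : Agrees I w known) (hw : IsWeight I w) :
    IsShortestPathTree I w (lazySPTree I known) := by
  refine ⟨⟨[I.source], isShortestPath_source, by simp⟩, ?_, ?_⟩
  · have : ¬ ∃ p, Pred I (currentWeight I known) p I.source := by
      rintro ⟨p, hp⟩; exact not_pred_source (h.isWeight hw) p hp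
    exact dif_neg this
  · rintro v ⟨P, hP, hk⟩
    refine ⟨P, h.isShortestPath hw hP hk, fun x hx => ?_, ?_⟩
    · obtain ⟨A, B, rfl⟩ := List.append_of_mem hx
      refine ⟨A ++ [x], hP.initialPart, fun e he => hk e ?_⟩
      rw [pathEdges_append_cons]
      exact List.mem_append_left _ he
    · refine hP.isChain_pred.imp fun a b hab => ?_
      have hex : ∃ p, Pred I (currentWeight I known) p b := ⟨a, hab⟩
      exact (dif_pos hex).trans (by rw [hex.choose_spec.unique (h.isWeight hw) hab])

variable [DecidableEq V]

/-- The values that LazySP has recorded after `n` steps. -/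
noncomputable abbrev lazySPKnown (I : Input V) (w : V × V → ℝ≥0∞) (n : ℕ) : V × V → Option ℝ≥0∞ :=
  (lazySP V).stateAt I w n

theorem lazySPKnown_succ (n : ℕ) : lazySPKnown I w (n + 1) =
    match lazySPAction I (lazySPKnown I w n) with
    | .eval e => Function.update (lazySPKnown I w n) e (some (w e))
    | .report _ => lazySPKnown I w n := by
  unfold lazySPKnown
  rw [Algorithm.stateAt_succ]
  change (match lazySPAction I ((lazySP V).stateAt I w n) with
    | .eval e => (lazySP V).next I ((lazySP V).stateAt I w n) (w e)
    | .report _ => (lazySP V).stateAt I w n) = _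
  cases h : lazySPAction I ((lazySP V).stateAt I w n) with
  | eval e => simp only [lazySP] at h ⊢; rw [h]
  | report r => rfl

theorem agrees_lazySPKnown (n : ℕ) : Agrees I w (lazySPKnown I w n) := by
  induction n with
  | zero => intro e y h; simp [lazySPKnown, Algorithm.stateAt, lazySP] at h
  | succ n ih =>
    rw [lazySPKnown_succ]
    split
    · next h => exact ih.update (lazySPAction_eq_eval_edge h).1
    · exact ih

theorem lazySPKnown_mono {m n : ℕ} (h : m ≤ n) {e : V × V} (he : lazySPKnown I w m e ≠ none) :
    lazySPKnown I w n e ≠ none := by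
  induction n, h using Nat.le_induction with
  | base => exact he
  | succ n _ ih =>
    rw [lazySPKnown_succ]
    split
    · next f _ =>
      by_cases hf : e = f
      · simp [hf]
      · rwa [Function.update_of_ne hf]
    · exact ih

/-- LazySP evaluates no edge twice. -/
theorem lazySP_eval_inj {m n : ℕ} {e : V × V} (hm : lazySPAction I (lazySPKnown I w m) = .eval e)
    (hn : lazySPAction I (lazySPKnown I w n) = .eval e) : m = n := by
  have aux : ∀ {m n : ℕ}, lazySPAction I (lazySPKnown I w m) = .eval e →
      lazySPAction I (lazySPKnown I w n) = .eval e → ¬ m < n := by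
    intro m n hm hn h
    refine lazySPKnown_mono (I := I) (w := w) (e := e) h ?_ (lazySPAction_eq_eval_edge hn).2
    rw [lazySPKnown_succ, hm]
    simp
  exact le_antisymm (not_lt.1 (aux hn hm)) (not_lt.1 (aux hm hn))

/-- Each evaluation concerns a new edge of a finite graph. -/
theorem lazySP_terminates : ∃ n r, lazySPAction I (lazySPKnown I w n) = .report r := by
  by_contra hcon
  have hev : ∀ n, ∃ e, lazySPAction I (lazySPKnown I w n) = .eval e := fun n => by
    cases h : lazySPAction I (lazySPKnown I w n) with
    | eval e => exact ⟨e, rfl⟩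
    | report r => exact absurd ⟨n, r, h⟩ hcon
  choose f hf using hev
  have hinj : Function.Injective f := fun m n h => lazySP_eval_inj (h ▸ hf m) (hf n)
  have : Finite ℕ := Finite.of_injective (fun n => (⟨f n, (lazySPAction_eq_eval_edge (hf n)).1⟩ :
    {e // e ∈ I.edges})) fun m n h => hinj (congrArg Subtype.val h)
  exact not_finite ℕ

theorem lazySP_report_some (hw : IsWeight I w) {n : ℕ} {P : List V}
    (h : lazySPAction I (lazySPKnown I w n) = .report (some P)) : IsShortestPath I w I.target P :=
  (agrees_lazySPKnown n).isShortestPath hw (lazySPAction_eq_report_some h).1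
    (lazySPAction_eq_report_some h).2

theorem lazySP_report_none [Finite V] (hw : IsWeight I w) {n : ℕ}
    (h : lazySPAction I (lazySPKnown I w n) = .report none) :
    ¬ ∃ P, IsShortestPath I w I.target P := by
  rintro ⟨P, hP⟩
  refine lazySPAction_eq_report_none h (exists_isShortestPath hP.1 (lt_of_le_of_lt ?_ hP.2.1))
  exact cost_mono fun e he =>
    (agrees_lazySPKnown n).currentWeight_le hw (mem_edges_of_isChain hP.1.1 he)

theorem inSP_lazySP [Finite V] : InSP (lazySP V) := by
  refine ⟨lazySPTree, fun I w hw =>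
    ⟨fun n => isShortestPathTree_lazySPTree (agrees_lazySPKnown n) hw, fun n e he => ?_,
      lazySP_terminates, fun n P h => lazySP_report_some hw h,
      fun n h => lazySP_report_none hw h⟩⟩
  refine ⟨(lazySPAction_eq_eval_edge he).1, ?_⟩
  obtain ⟨P, hP, hf⟩ := lazySPAction_eq_eval he
  obtain ⟨-, A, B, rfl, hA⟩ := exists_split_of_find? hf
  exact ⟨A ++ [e.1], hP.initialPart, fun f hf =>
    Option.isSome_iff_ne_none.1 (by simpa using hA f hf)⟩

/-- The current weights serve as the optimistic estimate. The edges before the first unevaluated one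
carry their true weights, which are finite because the path has finite cost. -/
theorem lazySP_testedEdges_subset {B : Algorithm V} (hB : InSP B) (hw : IsWeight I w) :
    (lazySP V).testedEdges I w ⊆ B.testedEdges I w := by
  rintro e ⟨n, hn⟩
  have hag : Agrees I w (lazySPKnown I w n) := agrees_lazySPKnown n
  obtain ⟨P, hP, hf⟩ := lazySPAction_eq_eval hn
  obtain ⟨-, L, M, hsplit, hL⟩ := List.find?_eq_some_iff_append.1 hf
  refine hB.mem_testedEdges hw (hag.isWeight hw) (fun e he => hag.currentWeight_le hw he) hP
    hsplit fun f hfL => ?_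
  have hk : lazySPKnown I w n f ≠ none := 
    Option.isSome_iff_ne_none.1 (by simpa using hL f hfL)
  rw [← hag.currentWeight_eq hk]
  exact (le_cost_of_mem (by rw [hsplit]; simp [hfL])).trans_lt hP.2.1

theorem lazySP_encard_evalTimes :
    ((lazySP V).evalTimes I w).encard ≤ ((lazySP V).testedEdges I w).encard := by
  have hex : ∀ n ∈ (lazySP V).evalTimes I w, ∃ e,
    lazySPAction I (lazySPKnown I w n) = .eval e := fun _ h => h
  have : Nonempty (V × V) := ⟨(I.source, I.source)⟩
  choose! f hf using hex
  have hinj : Set.InjOn f ((lazySP V).evalTimes I w) := fun m hm n hn h =>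
    lazySP_eval_inj (h ▸ hf m hm) (hf n hn)
  rw [← hinj.encard_image]
  refine Set.encard_le_encard ?_
  rintro _ ⟨n, hn, rfl⟩
  exact ⟨n, hf n hn⟩

/-- An algorithm of the family that always acts like LazySP is edge-optimal. -/
theorem edgeOptimal_of_action_eq {A : Algorithm V} (hA : InSP A)
    (h : ∀ (I : Input V) (w : V × V → ℝ≥0∞), IsWeight I w → ∀ n,
      A.action I (A.stateAt I w n) = lazySPAction I (lazySPKnown I w n)) : EdgeOptimal A := by
  refine ⟨hA, fun B hB I w hw => ?_⟩
  have h₁ : A.testedEdges I w = (lazySP V).testedEdges I w := by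
    ext e
    simp only [Algorithm.testedEdges, h I w hw]
    rfl
  have h₂ : A.evalTimes I w = (lazySP V).evalTimes I w := by
    ext e
    simp only [Algorithm.evalTimes, h I w hw]
    rfl
  have h₃ := Set.encard_le_encard (lazySP_testedEdges_subset hB hw)
  rw [h₁, h₂]
  exact ⟨h₃, lazySP_encard_evalTimes.trans (h₃.trans Algorithm.encard_testedEdges_le)⟩

end LazySP

/-! ### Invariants of loops -/

theorem whileLoop_of_not {σ : Type u} {cond : σ → Prop} {body : σ → σ} {s : σ} (h : ¬ cond s) :
    whileLoop cond body s = s := by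
  classical
  have hex : ∃ n, ¬ cond (body^[n] s) := ⟨0, h⟩
  have h0 : Nat.find hex = 0 := by simpa using h
  rw [whileLoop, dif_pos hex, h0]
  rfl

/-- `whileLoop` returns the initial state if the loop does not terminate, so the exit condition
needs the decreasing measure `μ`. -/
theorem whileLoop_induction {σ : Type u} {cond : σ → Prop} {body : σ → σ} (Inv : σ → Prop)
    (μ : σ → ℕ) (h : ∀ s, Inv s → cond s → Inv (body s) ∧ μ (body s) < μ s) {s : σ} (hs : Inv s) :
    Inv (whileLoop cond body s) ∧ ¬ cond (whileLoop cond body s) := by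
  classical
  have hex : ∃ n, ¬ cond (body^[n] s) := by
    induction hm : μ s using Nat.strong_induction_on generalizing s with
    | _ m ih =>
      by_cases hc : cond s
      · obtain ⟨h₁, h₂⟩ := h s hs hc
        obtain ⟨n, hn⟩ := ih _ (hm ▸ h₂) h₁ rfl
        exact ⟨n + 1, hn⟩
      · exact ⟨0, hc⟩
  have hinv : ∀ n ≤ Nat.find hex, Inv (body^[n] s) := by
    intro n
    induction n with
    | zero => exact fun _ => hs
    | succ n ih =>
      intro hn
      rw [Function.iterate_succ_apply']
      exact (h _ (ih (by omega)) (not_not.1 (Nat.find_min hex (by omega)))).1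
  rw [whileLoop, dif_pos hex]
  exact ⟨hinv _ le_rfl, Nat.find_spec hex⟩

/-- The invariant may mention the elements still to be processed; no order is assumed, since
`Finset.toList` enumerates a set arbitrarily. -/
theorem foldl_induction {σ : Type*} {β : Type*} (f : σ → β → σ) (Inv : List β → σ → Prop)
    (h : ∀ b L s, Inv (b :: L) s → Inv L (f s b)) :
    ∀ (L : List β) (s : σ), Inv L s → Inv [] (L.foldl f s)
  | [], _, hs => hs
  | b :: L, s, hs => foldl_induction f Inv h L (f s b) (h b L s hs)

/-! ### Entries of nodes -/

section Entries

variable {V : Type u} (I : Input V) (ω : V × V → ℝ≥0∞) (Ev : Set V)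

/-- The entry of `v` describes the shortest path to `v` for the weights `ω`, where `Ev` is the set
of the vertices to which all edges of the shortest path are evaluated. -/
structure IsFinal (v : V) (t : Entry V) : Prop where
  parent : ∀ p, t.parent = some p ↔ Pred I ω p v
  key : t.key = dist I ω v
  lt_top : dist I ω v < ∞
  b_ne_top : t.b ≠ ⊤
  b_eq_zero : t.b = 0 ↔ v ∈ Ev
  l_eq_zero : t.b = 0 → t.l = 0

/-- The entry of `v` is unset, or it was obtained by attaching `v` through an unevaluated edge to a
node whose key is its distance. -/
def IsTentative (v : V) (t : Entry V) : Prop :=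
  (t.parent = none ∧ t.key = ∞) ∨
    ∃ p, t.parent = some p ∧ (p, v) ∈ I.edges ∧ ω (p, v) < ∞ ∧ dist I ω p < ∞ ∧
      t.key = dist I ω p + ω (p, v) ∧ t.b ≠ 0 ∧ t.b ≠ ⊤

variable {I ω Ev}

theorem IsTentative.dist_le [Finite V] {v : V} {t : Entry V} (h : IsTentative I ω v t) :
    dist I ω v ≤ t.key := by
  rcases h with ⟨-, h⟩ | ⟨p, -, h₁, -, -, h₂, -⟩
  · simp [h]
  · rw [h₂]; exact dist_le_add h₁

/-- A tentative key is the cost of reaching `v` through its parent. If it does not exceed the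
distance, the parent edge is tight, and uniqueness makes the parent the predecessor. The nonzero
budget is consistent with `v ∉ Ev`. -/
theorem IsTentative.isFinal [Finite V] (hω : IsWeight I ω) {v : V} {t : Entry V}
    (h : IsTentative I ω v t) (hle : t.key ≤ dist I ω v) (hv : dist I ω v < ∞) (hE : v ∉ Ev) :
    IsFinal I ω Ev v t := by
  have hkey := le_antisymm hle h.dist_le
  rcases h with ⟨-, h⟩ | ⟨p, h₁, h₂, h₃, h₄, h₅, h₆, h₇⟩
  · rw [h] at hle; exact absurd hv (not_lt.2 hle)
  · have hp : Pred I ω p v := pred_of_le h₂ h₄ h₃ (h₅ ▸ hle)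
    refine ⟨fun q => ⟨fun hq => ?_, fun hq => ?_⟩, hkey, hv, h₇, by simp [h₆, hE],
      fun h => absurd h h₆⟩
    · rw [h₁, Option.some.injEq] at hq
      exact hq ▸ hp
    · rw [h₁, hp.unique hω hq]

/-! ### The weights underlying the search tree, and elementary facts about queues and entries -/

variable [DecidableEq V]

/-- The lazy weights of the edges in `E` that do not leave the target. -/
noncomputable def bandWeight (I : Input V) (E : Finset (V × V)) (e : V × V) : ℝ≥0∞ :=
  if e ∈ E ∧ e.1 ≠ I.target then I.lazyW e else ∞

theorem isWeight_bandWeight (E : Finset (V × V)) : IsWeight I (bandWeight I E) := by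
  intro e _
  unfold bandWeight
  split <;> simp

theorem bandWeight_lt_top {E : Finset (V × V)} {e : V × V} :
    bandWeight I E e < ∞ ↔ e ∈ E ∧ e.1 ≠ I.target := by
  unfold bandWeight
  split <;> simp_all

theorem Pred.mem_band {E : Finset (V × V)} {p v : V} (h : Pred I (bandWeight I E) p v) :
    (p, v) ∈ E ∧ p ≠ I.target :=
  bandWeight_lt_top.1 h.weight_lt_top

variable [Fintype V]

namespace LRAState

theorem key_childEntry (hω : IsWeight I ω) {s : LRAState V} {p v : V}
    (hp : (s.node p).key = dist I ω p) (hE : (p, v) ∈ I.edges) (hw : ω (p, v) < ∞) :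
    (s.childEntry I p v).key = dist I ω p + ω (p, v) := by
  rw [hω.eq_lazyW hE hw, ← hp]
  simp [childEntry, Entry.key, add_assoc]

theorem isTentative_childEntry (hω : IsWeight I ω) {s : LRAState V} {p v : V}
    (hp : IsFinal I ω Ev p (s.node p)) (hE : (p, v) ∈ I.edges) (hw : ω (p, v) < ∞) :
    IsTentative I ω v (s.childEntry I p v) :=
  Or.inr ⟨p, rfl, hE, hw, hp.lt_top, key_childEntry hω hp.key hE hw, by simp [childEntry],
    by simpa [childEntry] using hp.b_ne_top⟩

theorem top_mem {s : LRAState V} {Q : Finset V} (h : Q.Nonempty) : s.top I Q ∈ Q := by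
  rw [top, dif_pos h]
  exact (Q.exists_min_image _ h).choose_spec.1

theorem key_top_le {s : LRAState V} {Q : Finset V} {q : V} (hq : q ∈ Q) :
    (s.node (s.top I Q)).key ≤ (s.node q).key := by
  have h : Q.Nonempty := ⟨q, hq⟩
  rw [top, dif_pos h]
  exact (Q.exists_min_image (fun v => (s.node v).key) h).choose_spec.2 q hq

theorem mem_subtree {s : LRAState V} {v x : V} : x ∈ s.subtree v ↔
    x ∈ s.T ∧ Relation.ReflTransGen (fun a b => (s.node a).parent = some b) x v := by
  simp [subtree]

/-- Parent pointers followed from a vertex all of whose ancestors have final entries lead to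
ancestors. -/
theorem reflTransGen_pred_of_parent {s : LRAState V} {x v : V}
    (hx : ∀ y, Relation.ReflTransGen (Pred I ω) y x → IsFinal I ω Ev y (s.node y))
    (h : Relation.ReflTransGen (fun a b => (s.node a).parent = some b) x v) :
    Relation.ReflTransGen (Pred I ω) v x := by
  induction h with
  | refl => exact .refl
  | tail _ h ih => exact .head (((hx _ ih).parent _).1 h) ih

/-! ### Extending the band -/

/-- The parts of the state that extending the band does not touch. -/
structure Quiet (E : Finset (V × V)) (s : LRAState V) : Prop where
  E_eq : s.E = E
  result : s.result = none
  Qupdate : s.Qupdate = ∅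
  Qrewire : s.Qrewire = ∅
  Trewire : s.Trewire = ∅

variable (I Ev) in
/-- The invariant of extending the band; the successors `L` of `p` are still to be processed. -/
structure ExtInv (E : Finset (V × V)) (p : V) (L : List V) (s : LRAState V) : Prop where
  quiet : Quiet E s
  le_key : ∀ x, dist I (bandWeight I E) x ≤ (s.node x).key
  key_lt : ∀ x ∈ s.T, (s.node x).key < ∞
  sub : s.Qextend ⊆ s.T
  child : ∀ q x, Pred I (bandWeight I E) q x → q ∈ s.T → q ∉ s.Qextend → (q = p → x ∉ L) →
    x ∈ s.T ∧ IsFinal I (bandWeight I E) Ev x (s.node x)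
  final : ∀ x ∈ s.T, x ∉ s.Qextend → IsFinal I (bandWeight I E) Ev x (s.node x)
  ev : ∀ x ∈ Ev, x ∈ s.T ∧ IsFinal I (bandWeight I E) Ev x (s.node x)
  ext_ev : ∀ q ∈ s.Qextend, ∀ x, Pred I (bandWeight I E) q x → x ∉ Ev
  tgt : I.target ∈ s.T → I.target ∈ s.Qextend ∨ I.target ∈ s.Qfrontier
  front : ∀ x ∈ s.Qfrontier, x = I.target ∧ x ∈ s.T

variable (I Ev) in
/-- The facts about the set `Ev` of vertices to which the shortest path has been evaluated. -/
structure EvOK (E : Finset (V × V)) : Prop where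
  source : I.source ∈ Ev
  closed : ∀ p x, Pred I (bandWeight I E) p x → x ∈ Ev → p ∈ Ev

theorem extendChild_of_lt {s : LRAState V} {p v : V}
    (h : (s.childEntry I p v).key > (s.node v).key) : extendChild I ⊤ p s v = s := if_pos h

/-- `R` is the detached subtree, empty if `v` is new. Read contrapositively, the last clause says
that a tree vertex that is kept loses no child except possibly `v`. A finite budget never equals
`⊤`, so `v` always joins `Qextend`. -/
theorem extendChild_of_le {s : LRAState V} {p v : V}
    (h : ¬ (s.childEntry I p v).key > (s.node v).key) (hb : (s.node p).b ≠ ⊤) :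
    ∃ R : Finset V, extendChild I ⊤ p s v =
        { s with
          node := Function.update s.node v (s.childEntry I p v)
          T := insert v (s.T \ R)
          Qfrontier := s.Qfrontier \ R
          Qextend := insert v (s.Qextend \ R) } ∧
      (∀ x ∈ R, x ∈ s.T ∧ Relation.ReflTransGen (fun a b => (s.node a).parent = some b) x v) ∧
      ∀ x ∈ R, x ≠ v → ∀ q ∈ s.T, (s.node x).parent = some q → q ∈ R := by
  have hb' : ¬ (s.childEntry I p v).b = ⊤ := by simpa [childEntry] using hb
  by_cases hv : v ∈ s.T
  · refine ⟨s.subtree v, ?_, fun x hx => mem_subtree.1 hx, fun x hx hxv q hq hpar => ?_⟩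
    · simp [extendChild, h, hb', hv, setNode]
    · obtain ⟨h₁, h₂⟩ := mem_subtree.1 hx
      rcases Relation.ReflTransGen.cases_head h₂ with rfl | ⟨c, h₃, h₄⟩
      · exact absurd rfl hxv
      · rw [hpar, Option.some.injEq] at h₃
        exact mem_subtree.2 ⟨hq, h₃ ▸ h₄⟩
  · refine ⟨∅, ?_, by simp, by simp⟩
    simp [extendChild, h, hb', hv, setNode]

/-- The invariant during the processing of the successors of `p`, which was popped in the
state `s₀`. -/
structure ExtFold (I : Input V) (Ev : Set V) (E : Finset (V × V)) (s₀ : LRAState V) (p : V)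
    (L : List V) (s : LRAState V) : Prop where
  inv : ExtInv I Ev E p L s
  mem : ∀ v ∈ L, (p, v) ∈ E
  ancestors : ∀ q, Relation.ReflTransGen (Pred I (bandWeight I E)) q p →
    q ∈ s.T ∧ q ∉ s.Qextend
  unsettled : ∀ q, q ∉ s.T ∨ q ∈ s.Qextend → ∃ y, Relation.ReflTransGen
    (Pred I (bandWeight I E)) y q ∧ (y ∉ s₀.T ∨ y ∈ s₀.Qextend)

/-- A child is attached even if the keys are equal, so a vertex with a final entry can be attached
again, and settled vertices can be detached with it. By uniqueness this happens only through its
true predecessor `p`, which protects the vertices of `Ev` and the ancestors of `p`. -/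
theorem ExtFold.step {E : Finset (V × V)} (hE : E ⊆ I.edges) (hEv : EvOK I Ev E)
    {s₀ s : LRAState V} {p v : V} {L : List V} (hp₀ : p ∈ s₀.Qextend) (hpt : p ≠ I.target)
    (hpev : ∀ x, Pred I (bandWeight I E) p x → x ∉ Ev)
    (h : ExtFold I Ev E s₀ p (v :: L) s) : ExtFold I Ev E s₀ p L (extendChild I ⊤ p s v) := by
  have hω : IsWeight I (bandWeight I E) := isWeight_bandWeight E
  obtain ⟨hI, hmem, hanc, huns⟩ := h
  have hpv := hmem v (by simp)
  have hw : bandWeight I E (p, v) < ∞ := bandWeight_lt_top.2 ⟨hpv, hpt⟩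
  obtain ⟨hpT, hpQ⟩ := hanc p .refl
  have hpf := hI.final p hpT hpQ
  have hkey := key_childEntry hω hpf.key (hE hpv) hw
  have hmem' : ∀ x ∈ L, (p, x) ∈ E := fun x hx => hmem x (by simp [hx])
  by_cases hlt : (s.childEntry I p v).key > (s.node v).key
  · rw [extendChild_of_lt hlt]
    refine ⟨{ hI with child := fun q x hqx hq hq' hL => ?_ }, hmem', hanc, huns⟩
    refine hI.child q x hqx hq hq' fun hqp => ?_
    rw [List.mem_cons, not_or]
    refine ⟨?_, hL hqp⟩
    rintro rfl
    subst hqp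
    -- For a successor of `p` the offered key is its distance, and no key is smaller than that.
    rw [hkey, ← hqx.2.1] at hlt
    exact absurd (hI.le_key x) (not_le.2 hlt)
  · have htent := isTentative_childEntry hω hpf (hE hpv) hw
    -- a vertex with a final entry that is attached again is a successor of `p`
    have hpred : IsFinal I (bandWeight I E) Ev v (s.node v) → Pred I (bandWeight I E) p v := by
      intro hv
      rw [hkey, hv.key, gt_iff_lt, not_lt] at hlt
      exact pred_of_le (hE hpv) hpf.lt_top hw hlt
    have hvEv : v ∉ Ev := fun hv => hpev v (hpred (hI.ev v hv).2) hv
    -- Ancestors of `p` have final entries. Attaching one below `p` would make its distance exceed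
    -- that of `p`.
    have hvanc : ¬ Relation.ReflTransGen (Pred I (bandWeight I E)) v p := by
      intro hv
      obtain ⟨h₁, h₂⟩ := hanc v hv
      have h₃ := (hpred (hI.final v h₁ h₂)).dist_lt hω
      exact absurd (dist_le_of_reflTransGen hv) (not_le.2 h₃)
    obtain ⟨R, heq, hR, hRc⟩ := extendChild_of_le hlt hpf.b_ne_top
    -- Parent pointers starting in `Ev` stay in `Ev`, whereas those starting in `R` lead to `v`.
    have hREv : ∀ x ∈ R, x ∉ Ev := by
      intro x hx hxE
      obtain ⟨-, hx⟩ := hR x hx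
      have aux : ∀ y, Relation.ReflTransGen (fun a b => (s.node a).parent = some b) x y →
          y ∈ Ev := by
        intro y hy
        induction hy with
        | refl => exact hxE
        | tail _ h ih => exact hEv.closed _ _ (((hI.ev _ ih).2.parent _).1 h) ih
      exact hvEv (aux v hx)
    have hRanc : ∀ q, Relation.ReflTransGen (Pred I (bandWeight I E)) q p → q ∉ R := by
      intro q hq hqR
      have := reflTransGen_pred_of_parent (Ev := Ev) (fun y hy =>
        hI.final y (hanc y (hy.trans hq)).1 (hanc y (hy.trans hq)).2) (hR q hqR).2
      exact hvanc (this.trans hq)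
    -- a settled vertex that is removed has an ancestor that was unsettled when `p` was popped
    have hunset : ∀ q, q ∈ s.T → q ∉ s.Qextend →
        Relation.ReflTransGen (fun a b => (s.node a).parent = some b) q v →
        ∃ y, Relation.ReflTransGen (Pred I (bandWeight I E)) y q ∧
          (y ∉ s₀.T ∨ y ∈ s₀.Qextend) := by
      intro q hq hq' hqv
      induction hqv using Relation.ReflTransGen.head_induction_on with
      | refl => exact ⟨p, .single (hpred (hI.final v hq hq')), Or.inr hp₀⟩
      | @head a c h _ ih =>
        have hca := ((hI.final a hq hq').parent c).1 h
        by_cases hc : c ∈ s.T ∧ c ∉ s.Qextend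
        · obtain ⟨y, h₁, h₂⟩ := ih hc.1 hc.2
          exact ⟨y, h₁.tail hca, h₂⟩
        · obtain ⟨y, h₁, h₂⟩ := huns c (by tauto)
          exact ⟨y, h₁.tail hca, h₂⟩
    rw [heq]
    refine ⟨⟨⟨hI.quiet.1, hI.quiet.2, hI.quiet.3, hI.quiet.4, hI.quiet.5⟩, ?_, ?_, ?_, ?_, ?_, ?_,
      ?_, ?_, ?_⟩, hmem', ?_, ?_⟩
    · intro x
      by_cases hx : x = v
      · subst hx; simpa using htent.dist_le
      · simpa [hx] using hI.le_key x
    · intro x hxT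
      by_cases hx : x = v
      · subst hx
        simpa [hkey] using ⟨hpf.lt_top, hw⟩
      · simp [hx] at hxT
        simpa [hx] using hI.key_lt x hxT.1
    · exact Finset.insert_subset_insert _ (Finset.sdiff_subset_sdiff hI.sub subset_rfl)
    · intro q x hqx hq hq' hL
      simp only [Finset.mem_insert, Finset.mem_sdiff, not_or, not_and, not_not] at hq hq' ⊢
      obtain ⟨hqT, hqR⟩ := hq.resolve_left hq'.1
      have hqQ : q ∉ s.Qextend := fun hh => hqR (hq'.2 hh)
      by_cases hxv : x = v
      · subst hxv
        -- If `q` were a settled vertex other than `p`, its child would already be final, and being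
        -- attached again would make `p` its predecessor.
        have hqp : q = p := by
          by_contra hne
          exact hne (hqx.unique hω (hpred (hI.child q x hqx hqT hqQ (fun h => absurd h hne)).2))
        subst hqp
        refine ⟨Or.inl rfl, ?_⟩
        simpa using htent.isFinal hω (by rw [hkey, hqx.2.1]) hqx.2.2 hvEv
      · obtain ⟨h₁, h₂⟩ := hI.child q x hqx hqT hqQ (fun h => by simp [hxv, hL h])
        refine ⟨Or.inr ⟨h₁, fun hxR => hqR ?_⟩, by simpa [hxv] using h₂⟩
        exact hRc x hxR hxv q hqT ((h₂.parent q).2 hqx)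
    · intro x hxT hxQ
      simp only [Finset.mem_insert, Finset.mem_sdiff, not_or, not_and, not_not] at hxT hxQ ⊢
      obtain ⟨h₁, h₂⟩ := hxT.resolve_left hxQ.1
      simpa [hxQ.1] using hI.final x h₁ (fun hh => h₂ (hxQ.2 hh))
    · intro x hx
      have hxv : x ≠ v := fun h => hvEv (h ▸ hx)
      have hxR : x ∉ R := fun h => hREv x h hx
      simpa [hxv, hxR] using hI.ev x hx
    · intro q hq x hqx hx
      simp only [Finset.mem_insert, Finset.mem_sdiff] at hq
      rcases hq with rfl | hq
      · exact hvEv (hEv.closed _ _ hqx hx)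
      · exact hI.ext_ev q hq.1 x hqx hx
    · intro ht
      simp only [Finset.mem_insert, Finset.mem_sdiff] at ht ⊢
      rcases ht with ht | ht
      · exact Or.inl (Or.inl ht)
      · rcases hI.tgt ht.1 with h | h
        · exact Or.inl (Or.inr ⟨h, ht.2⟩)
        · exact Or.inr ⟨h, ht.2⟩
    · intro x hx
      simp only [Finset.mem_insert, Finset.mem_sdiff] at hx ⊢
      exact ⟨(hI.front x hx.1).1, Or.inr ⟨(hI.front x hx.1).2, hx.2⟩⟩
    · intro q hq
      have hqv : q ≠ v := fun h => hvanc (h ▸ hq)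
      simp [hqv, hRanc q hq, hanc q hq]
    · intro q hq
      simp only [Finset.mem_insert, Finset.mem_sdiff, not_or, not_and, not_not] at hq
      by_cases hs : q ∉ s.T ∨ q ∈ s.Qextend
      · exact huns q hs
      · rw [not_or, not_not] at hs
        refine hunset q hs.1 hs.2 ?_
        rcases hq with hq | hq
        · exact (hR q (hq.2 hs.1)).2
        · rcases hq with rfl | hq
          · exact .refl
          · exact absurd hq.1 hs.2

open Classical in
/-- The number of vertices whose shortest path is not yet settled. -/
noncomputable def unsettledCount (I : Input V) (E : Finset (V × V)) (s : LRAState V) : ℕ :=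
  (Finset.univ.filter fun x => ∃ y, Relation.ReflTransGen (Pred I (bandWeight I E)) y x ∧
    (y ∉ s.T ∨ y ∈ s.Qextend)).card

/-- `dijkstra_min` settles the popped vertex together with all its ancestors. Attaching a vertex
again may unsettle others, but only ones below a vertex that was already unsettled; as the measure
also counts descendants of unsettled vertices, it still drops. -/
theorem extendBody_spec {E : Finset (V × V)} (hE : E ⊆ I.edges) (hEv : EvOK I Ev E)
    {s : LRAState V} {p₀ : V} (hI : ExtInv I Ev E p₀ [] s) (hne : s.Qextend.Nonempty) :
    ExtInv I Ev E p₀ [] (extendBody I ⊤ s) ∧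
      unsettledCount I E (extendBody I ⊤ s) < unsettledCount I E s := by
  classical
  have hω : IsWeight I (bandWeight I E) := isWeight_bandWeight E
  set p := s.top I s.Qextend with hp
  have hpQ : p ∈ s.Qextend := top_mem hne
  have hpd : dist I (bandWeight I E) p < ∞ :=
    (hI.le_key p).trans_lt (hI.key_lt p (hI.sub hpQ))
  obtain ⟨hpk, hpanc⟩ := dijkstra_min hω (S := {x | x ∈ s.T ∧ x ∉ s.Qextend}) (Q := s.Qextend)
    (key := fun x => (s.node x).key) (p := p)
    (by
      obtain ⟨h₁, h₂⟩ := hI.ev _ hEv.source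
      by_cases hs : I.source ∈ s.Qextend
      · exact Or.inr ⟨hs, by simp [h₂.key]⟩
      · exact Or.inl ⟨h₁, hs⟩)
    (fun x y hx hxy hy => by
      obtain ⟨h₁, h₂⟩ := hI.child x y hxy hx.1 hx.2 (by simp)
      refine ⟨?_, h₂.key.le⟩
      by_contra hyQ
      exact hy ⟨h₁, hyQ⟩)
    (hI.le_key p) (fun q hq => key_top_le hq) (fun h => h.2 hpQ) hpd
  have hpf : IsFinal I (bandWeight I E) Ev p (s.node p) := by
    by_cases hs : p = I.source
    · rw [hs]; exact (hI.ev _ hEv.source).2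
    · obtain ⟨q, hq⟩ := exists_pred hpd hs
      obtain ⟨h₁, h₂⟩ := hpanc q (.single hq)
      exact (hI.child q p hq h₁ h₂ (by simp)).2
  have hpT := hI.sub hpQ
  -- both branches settle `p` and unsettle only descendants of unsettled vertices
  have hcount : ∀ s' : LRAState V,
      (∀ q, Relation.ReflTransGen (Pred I (bandWeight I E)) q p → q ∈ s'.T ∧ q ∉ s'.Qextend) →
      (∀ q, q ∉ s'.T ∨ q ∈ s'.Qextend → ∃ y, Relation.ReflTransGen
        (Pred I (bandWeight I E)) y q ∧ (y ∉ s.T ∨ y ∈ s.Qextend)) →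
      unsettledCount I E s' < unsettledCount I E s := by
    intro s' h₁ h₂
    refine Finset.card_lt_card ((Finset.ssubset_iff_of_subset ?_).2 ⟨p, ?_, ?_⟩)
    · intro x hx
      simp only [Finset.mem_filter, Finset.mem_univ, true_and] at hx ⊢
      obtain ⟨y, hy, hy'⟩ := hx
      obtain ⟨z, hz, hz'⟩ := h₂ y hy'
      exact ⟨z, hz.trans hy, hz'⟩
    · simp only [Finset.mem_filter, Finset.mem_univ, true_and]
      exact ⟨p, .refl, Or.inr hpQ⟩
    · simp only [Finset.mem_filter, Finset.mem_univ, true_and, not_exists, not_and]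
      intro y hy hy'
      have := h₁ y hy
      tauto
  have hanc₁ : ∀ q, Relation.ReflTransGen (Pred I (bandWeight I E)) q p →
      q ∈ s.T ∧ q ∉ s.Qextend.erase p := by
    intro q hq
    rcases Relation.reflTransGen_iff_eq_or_transGen.1 hq with rfl | hq
    · exact ⟨hpT, by simp⟩
    · exact ⟨(hpanc q hq).1, fun h => (hpanc q hq).2 (Finset.mem_of_mem_erase h)⟩
  have huns₁ : ∀ q, q ∉ s.T ∨ q ∈ s.Qextend.erase p → ∃ y, Relation.ReflTransGen
        (Pred I (bandWeight I E)) y q ∧ (y ∉ s.T ∨ y ∈ s.Qextend) := fun q hq =>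
    ⟨q, .refl, hq.imp id Finset.mem_of_mem_erase⟩
  have hfin₁ : ∀ x ∈ s.T, x ∉ s.Qextend.erase p →
      IsFinal I (bandWeight I E) Ev x (s.node x) := by
    intro x hx hxQ
    by_cases hxp : x = p
    · rw [hxp]; exact hpf
    · exact hI.final x hx fun h => hxQ (Finset.mem_erase.2 ⟨hxp, h⟩)
  by_cases hpt : p = I.target
  · have heq : extendBody I ⊤ s =
        { s with Qextend := s.Qextend.erase p, Qfrontier := insert p s.Qfrontier } := by
      simp only [extendBody, ← hp]
      rw [if_pos hpt]
    rw [heq]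
    refine ⟨⟨⟨hI.quiet.1, hI.quiet.2, hI.quiet.3, hI.quiet.4, hI.quiet.5⟩, hI.le_key, hI.key_lt,
      (Finset.erase_subset _ _).trans hI.sub, ?_, hfin₁, hI.ev,
      fun q hq => hI.ext_ev q (Finset.mem_of_mem_erase hq), ?_, ?_⟩, hcount _ hanc₁ huns₁⟩
    · intro q x hqx hq hqQ _
      -- The target is not extended, but its outgoing edges have weight `∞`, so it has no successors
      -- to settle.
      have hqp : q ≠ p := fun h => hqx.mem_band.2 (h.trans hpt)
      exact hI.child q x hqx hq (fun h => hqQ (Finset.mem_erase.2 ⟨hqp, h⟩)) (by simp)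
    · intro _
      exact Or.inr (by simp [hpt])
    · intro x hx
      rcases Finset.mem_insert.1 hx with rfl | hx
      · exact ⟨hpt, hpT⟩
      · exact hI.front x hx
  · set s₁ : LRAState V := { s with Qextend := s.Qextend.erase p } with hs₁
    set L := (Finset.univ.filter fun v => (p, v) ∈ s.E).toList with hL
    have heq : extendBody I ⊤ s = L.foldl (extendChild I ⊤ p) s₁ := by
      simp only [extendBody, ← hp]
      rw [if_neg hpt]
    have hLmem : ∀ v, v ∈ L ↔ (p, v) ∈ E := by simp [hL, hI.quiet.E_eq]
    have h₀ : ExtFold I Ev E s p L s₁ := by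
      refine ⟨⟨⟨hI.quiet.1, hI.quiet.2, hI.quiet.3, hI.quiet.4, hI.quiet.5⟩, hI.le_key, hI.key_lt,
        (Finset.erase_subset _ _).trans hI.sub, ?_, hfin₁, hI.ev,
        fun q hq => hI.ext_ev q (Finset.mem_of_mem_erase hq), ?_, hI.front⟩,
        fun v hv => (hLmem v).1 hv, hanc₁, huns₁⟩
      · intro q x hqx hq hqQ hqL
        have hqp : q ≠ p := fun h => hqL h ((hLmem x).2 (h ▸ hqx.mem_band.1))
        exact hI.child q x hqx hq (fun h => hqQ (Finset.mem_erase.2 ⟨hqp, h⟩)) (by simp)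
      · intro ht
        rcases hI.tgt ht with h | h
        · exact Or.inl (Finset.mem_erase.2 ⟨Ne.symm hpt, h⟩)
        · exact Or.inr h
    have h₁ := foldl_induction (extendChild I ⊤ p) (fun L s' => ExtFold I Ev E s p L s')
      (fun v L s' h => h.step hE hEv hpQ hpt (hI.ext_ev p hpQ)) L s₁ h₀
    rw [← heq] at h₁
    exact ⟨{ h₁.inv with child := fun q x hqx hq hq' _ => h₁.inv.child q x hqx hq hq' (by simp) },
      hcount _ h₁.ancestors h₁.unsettled⟩

variable (I Ev) in
/-- The invariant of the main loop. -/
structure Stable (E : Finset (V × V)) (s : LRAState V) : Prop where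
  quiet : Quiet E s
  Qextend : s.Qextend = ∅
  mem_T : ∀ x, x ∈ s.T ↔ dist I (bandWeight I E) x < ∞
  le_key : ∀ x, dist I (bandWeight I E) x ≤ (s.node x).key
  final : ∀ x ∈ s.T, IsFinal I (bandWeight I E) Ev x (s.node x)
  front : ∀ x, x ∈ s.Qfrontier ↔ x = I.target ∧ x ∈ s.T

/-- With `Qextend` empty every tree vertex is settled, so the tree is closed under successors; as it
contains the source, it contains every vertex of finite distance. -/
theorem stable_extendBand {E : Finset (V × V)} (hE : E ⊆ I.edges) (hEv : EvOK I Ev E)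
    {s : LRAState V} {p₀ : V} (hI : ExtInv I Ev E p₀ [] s) : Stable I Ev E (extendBand I ⊤ s) := by
  obtain ⟨h, hQ⟩ := whileLoop_induction (ExtInv I Ev E p₀ []) (unsettledCount I E)
    (fun s hs hc => extendBody_spec hE hEv hs hc) hI
  rw [Finset.not_nonempty_iff_eq_empty] at hQ
  change ExtInv I Ev E p₀ [] (extendBand I ⊤ s) at h
  change (extendBand I ⊤ s).Qextend = ∅ at hQ
  refine ⟨h.quiet, hQ, fun x => ⟨fun hx => (h.le_key x).trans_lt (h.key_lt x hx), fun hx => ?_⟩,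
    h.le_key, fun x hx => h.final x hx (by simp [hQ]), fun x => ⟨h.front x, ?_⟩⟩
  · exact dist_induction (h.ev _ hEv.source).1
      (fun p v hpv hp => (h.child p v hpv hp (by simp [hQ]) (by simp)).1) hx
  · rintro ⟨rfl, hx⟩
    exact (h.tgt hx).resolve_left (by simp [hQ])

theorem isFinal_source (hω : IsWeight I ω) (hs : I.source ∈ Ev) :
    IsFinal I ω Ev I.source ⟨none, 0, 0, 0⟩ :=
  ⟨fun p => by simpa using not_pred_source hω p, by simp [Entry.key], by simp, by simp,
    by simpa using hs, fun _ => rfl⟩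

theorem evOK_singleton (E : Finset (V × V)) : EvOK I {I.source} E :=
  ⟨rfl, fun p x h hx => by
    rw [Set.mem_singleton_iff] at hx
    exact absurd (hx ▸ h) (not_pred_source (isWeight_bandWeight E) p)⟩

theorem stable_start : Stable I {I.source} I.edges (start I ⊤) := by
  have hω : IsWeight I (bandWeight I I.edges) := isWeight_bandWeight I.edges
  have hs := isFinal_source (Ev := {I.source}) hω rfl
  refine stable_extendBand (p₀ := I.source) subset_rfl (evOK_singleton _)
    ⟨⟨rfl, rfl, rfl, rfl, rfl⟩, ?_, ?_, subset_rfl, ?_, ?_, ?_, ?_, ?_, by simp⟩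
  · intro x
    by_cases hx : x = I.source
    · subst hx; simp
    · simp [hx, Entry.unset, Entry.key]
  · intro x hx
    rw [Finset.mem_singleton.1 hx]; simp [Entry.key]
  · intro q x _ h₁ h₂; exact absurd h₁ h₂
  · intro x h₁ h₂; exact absurd h₁ h₂
  · intro x hx
    rw [Set.mem_singleton_iff] at hx
    subst hx
    simpa using hs
  · intro q _ x hqx hx
    rw [Set.mem_singleton_iff] at hx
    exact not_pred_source hω q (hx ▸ hqx)
  · intro h; exact Or.inl h

end LRAState

end Entries

namespace LRAState

variable {V : Type u} [Fintype V] [DecidableEq V] {I : Input V} {Ev : Set V}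
  {E : Finset (V × V)}

/-! ### Updating the band -/

variable (I Ev) in
/-- The invariant of updating the band, apart from the fact that the target will be reached. -/
structure UpdInv (E : Finset (V × V)) (s : LRAState V) : Prop where
  E_eq : s.E = E
  result : s.result = none
  Qrewire : s.Qrewire = ∅
  Trewire : s.Trewire = ∅
  Qfrontier : s.Qfrontier = ∅
  mem_T : ∀ x, x ∈ s.T ↔ dist I (bandWeight I E) x < ∞
  le_key : ∀ x, dist I (bandWeight I E) x ≤ (s.node x).key
  final : ∀ x ∈ s.T, IsFinal I (bandWeight I E) Ev x (s.node x)
  upd_sub : s.Qupdate ⊆ s.T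
  ext_sub : s.Qextend ⊆ s.T
  upd_ev : ∀ q ∈ s.Qupdate, ∀ x, Pred I (bandWeight I E) q x → x ∉ Ev
  ext_ev : ∀ q ∈ s.Qextend, ∀ x, Pred I (bandWeight I E) q x → x ∉ Ev

/-- The invariant while the successors `L` of `p` remain to be updated. -/
structure UpdFold (I : Input V) (Ev : Set V) (E : Finset (V × V)) (s₀ : LRAState V) (p : V)
    (L : List V) (s : LRAState V) : Prop where
  inv : UpdInv I Ev E s
  mem : ∀ v ∈ L, Pred I (bandWeight I E) p v
  done : ∀ v, Pred I (bandWeight I E) p v → v ∈ L ∨ v ∈ s.Qupdate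
  Qextend_eq : s.Qextend = s₀.Qextend
  sub : s₀.Qupdate ⊆ s.Qupdate
  sup : ∀ x ∈ s.Qupdate, x ∈ s₀.Qupdate ∨ Pred I (bandWeight I E) p x

/-- The parent is already the predecessor, so recomputing the entry from it gives a final entry
again. -/
theorem UpdFold.step (hEv : EvOK I Ev E) {s₀ s : LRAState V} {p v : V} {L : List V}
    (hpev : ∀ x, Pred I (bandWeight I E) p x → x ∉ Ev)
    (h : UpdFold I Ev E s₀ p (v :: L) s) : UpdFold I Ev E s₀ p L (updateChild I ⊤ p s v) := by
  have hω : IsWeight I (bandWeight I E) := isWeight_bandWeight E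
  obtain ⟨hI, hmem, hdone, hQ, hsub, hsup⟩ := h
  have hpv := hmem v (by simp)
  have hvT : v ∈ s.T := (hI.mem_T v).2 hpv.2.2
  have hpf := hI.final p ((hI.mem_T p).2 hpv.dist_lt_top)
  have hvf : IsFinal I (bandWeight I E) Ev v (s.childEntry I p v) :=
    (isTentative_childEntry hω hpf hpv.1 hpv.weight_lt_top).isFinal hω
      (by rw [key_childEntry hω hpf.key hpv.1 hpv.weight_lt_top, hpv.2.1]) hpv.2.2 (hpev v hpv)
  have heq : updateChild I ⊤ p s v =
      { s with
        node := Function.update s.node v (s.childEntry I p v)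
        Qupdate := insert v s.Qupdate } := by
    simp [updateChild, (hI.final v hvT).b_ne_top, setNode]
  rw [heq]
  refine ⟨⟨hI.E_eq, hI.result, hI.Qrewire, hI.Trewire, hI.Qfrontier, hI.mem_T, fun x => ?_,
    fun x hx => ?_, Finset.insert_subset hvT hI.upd_sub, hI.ext_sub, fun q hq x hqx hx => ?_,
    hI.ext_ev⟩, fun x hx => hmem x (by simp [hx]), fun x hx => ?_, hQ,
    hsub.trans (Finset.subset_insert _ _), fun x hx => ?_⟩
  · by_cases hxv : x = v
    · subst hxv; simpa using hvf.key.ge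
    · simpa [hxv] using hI.le_key x
  · by_cases hxv : x = v
    · subst hxv; simpa using hvf
    · simpa [hxv] using hI.final x hx
  · rcases Finset.mem_insert.1 hq with rfl | hq
    · exact hpev _ hpv (hEv.closed _ _ hqx hx)
    · exact hI.upd_ev q hq x hqx hx
  · rcases hdone x hx with h | h
    · rcases List.mem_cons.1 h with rfl | h
      · exact Or.inr (by simp)
      · exact Or.inl h
    · exact Or.inr (by simp [h])
  · rcases Finset.mem_insert.1 hx with rfl | hx
    · exact Or.inr hpv
    · exact hsup x hx

open Classical in
/-- The number of descendants of the vertices that are to be updated. -/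
noncomputable def pendingCount (I : Input V) (E : Finset (V × V)) (s : LRAState V) : ℕ :=
  (Finset.univ.filter fun x => ∃ y, Relation.ReflTransGen (Pred I (bandWeight I E)) y x ∧
    y ∈ s.Qupdate).card

/-- The target was taken out of the frontier and must get back. `htgt` follows an ancestor of it
through the queue until the target, having no successors, enters `Qextend`. The count drops because
`p` has minimal distance and so lies below no vertex that remains in or enters the queue. -/
theorem updateBody_spec (hEv : EvOK I Ev E) {s : LRAState V} (hI : UpdInv I Ev E s)
    (htgt : I.target ∈ s.Qextend ∨ ∃ y ∈ s.Qupdate,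
      Relation.ReflTransGen (Pred I (bandWeight I E)) y I.target)
    (hne : s.Qupdate.Nonempty) :
    (UpdInv I Ev E (updateBody I ⊤ s) ∧ (I.target ∈ (updateBody I ⊤ s).Qextend ∨
      ∃ y ∈ (updateBody I ⊤ s).Qupdate,
        Relation.ReflTransGen (Pred I (bandWeight I E)) y I.target)) ∧
      pendingCount I E (updateBody I ⊤ s) < pendingCount I E s := by
  classical
  have hω : IsWeight I (bandWeight I E) := isWeight_bandWeight E
  set p := s.top I s.Qupdate with hp
  have hpQ : p ∈ s.Qupdate := top_mem hne
  have hpT := hI.upd_sub hpQ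
  have hmin : ∀ q ∈ s.Qupdate, dist I (bandWeight I E) p ≤ dist I (bandWeight I E) q := by
    intro q hq
    rw [← (hI.final q (hI.upd_sub hq)).key, ← (hI.final p hpT).key]
    exact key_top_le hq
  have hcount : ∀ s' : LRAState V, (∀ x ∈ s'.Qupdate,
      x ∈ s.Qupdate.erase p ∨ Pred I (bandWeight I E) p x) →
      pendingCount I E s' < pendingCount I E s := by
    intro s' h'
    refine Finset.card_lt_card ((Finset.ssubset_iff_of_subset ?_).2 ⟨p, ?_, ?_⟩)
    · intro x hx
      simp only [Finset.mem_filter, Finset.mem_univ, true_and] at hx ⊢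
      obtain ⟨y, hy, hy'⟩ := hx
      rcases h' y hy' with h | h
      · exact ⟨y, hy, Finset.mem_of_mem_erase h⟩
      · exact ⟨p, .head h hy, hpQ⟩
    · simp only [Finset.mem_filter, Finset.mem_univ, true_and]
      exact ⟨p, .refl, hpQ⟩
    · simp only [Finset.mem_filter, Finset.mem_univ, true_and, not_exists, not_and]
      intro y hy hy'
      rcases h' y hy' with h | h
      · rw [Finset.mem_erase] at h
        rcases Relation.reflTransGen_iff_eq_or_transGen.1 hy with h₁ | h₁
        · exact h.1 h₁.symm
        · exact absurd (hmin y h.2) (not_le.2 (dist_lt_of_transGen hω h₁))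
      · exact absurd (dist_le_of_reflTransGen hy) (not_le.2 (h.dist_lt hω))
  set s₁ : LRAState V := { s with Qupdate := s.Qupdate.erase p } with hs₁
  set succ := s.T.filter fun v => (s.node v).parent = some p with hsucc
  have hmem : ∀ v, v ∈ succ ↔ Pred I (bandWeight I E) p v := by
    intro v
    simp only [hsucc, Finset.mem_filter]
    refine ⟨fun h => ((hI.final v h.1).parent p).1 h.2, fun h => ?_⟩
    have hv := (hI.mem_T v).2 h.2.2
    exact ⟨hv, ((hI.final v hv).parent p).2 h⟩
  have hI₁ : UpdInv I Ev E s₁ :=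
    { hI with
      upd_sub := (Finset.erase_subset _ _).trans hI.upd_sub
      upd_ev := fun q hq => hI.upd_ev q (Finset.mem_of_mem_erase hq) }
  by_cases hemp : succ = ∅
  · have heq : updateBody I ⊤ s = { s₁ with Qextend := insert p s.Qextend } := by
      simp only [updateBody, ← hp]
      rw [if_pos hemp]
    rw [heq]
    refine ⟨⟨{ hI₁ with
      ext_sub := Finset.insert_subset hpT hI.ext_sub
      ext_ev := fun q hq => ?_ }, ?_⟩, hcount _ fun x hx => Or.inl hx⟩
    · rcases Finset.mem_insert.1 hq with rfl | hq
      · exact hI.upd_ev _ hpQ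
      · exact hI.ext_ev q hq
    · rcases htgt with h | ⟨y, hy, h⟩
      · exact Or.inl (by simp [h])
      · by_cases hyp : y = p
        · left
          subst hyp
          rcases Relation.ReflTransGen.cases_head h with h | ⟨c, hc, -⟩
          · simp [← h]
          · have := (hmem c).2 hc
            simp [hemp] at this
        · exact Or.inr ⟨y, Finset.mem_erase.2 ⟨hyp, hy⟩, h⟩
  · have heq : updateBody I ⊤ s = succ.toList.foldl (updateChild I ⊤ p) s₁ := by
      simp only [updateBody, ← hp]
      rw [if_neg hemp]
    have h₀ : UpdFold I Ev E s₁ p succ.toList s₁ :=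
      ⟨hI₁, fun v hv => (hmem v).1 (by simpa using hv),
        fun v hv => Or.inl (by simpa using (hmem v).2 hv), rfl, subset_rfl,
        fun x hx => Or.inl hx⟩
    have h₁ := foldl_induction (updateChild I ⊤ p) (fun L s' => UpdFold I Ev E s₁ p L s')
      (fun v L s' h => h.step hEv (hI.upd_ev p hpQ)) _ s₁ h₀
    rw [← heq] at h₁
    refine ⟨⟨h₁.inv, ?_⟩, hcount _ h₁.sup⟩
    rcases htgt with h | ⟨y, hy, h⟩
    · exact Or.inl (by rw [h₁.Qextend_eq]; exact h)
    · by_cases hyp : y = p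
      · subst hyp
        rcases Relation.ReflTransGen.cases_head h with h | ⟨c, hc, hc'⟩
        · obtain ⟨c, hc⟩ := Finset.nonempty_iff_ne_empty.2 hemp
          exact absurd h ((hmem c).1 hc).mem_band.2
        · exact Or.inr ⟨c, (h₁.done c hc).resolve_left (by simp), hc'⟩
      · exact Or.inr ⟨y, h₁.sub (Finset.mem_erase.2 ⟨hyp, hy⟩), h⟩

/-- The tree still spans every reachable vertex with final entries; all that is left for the
extension is to return the target to the frontier. -/
theorem extInv_updateBand (hEv : EvOK I Ev E)
    (hEvd : ∀ x ∈ Ev, dist I (bandWeight I E) x < ∞) {s : LRAState V} (hI : UpdInv I Ev E s)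
    {y : V} (hy : y ∈ s.Qupdate)
    (hyt : Relation.ReflTransGen (Pred I (bandWeight I E)) y I.target) (p₀ : V) :
    ExtInv I Ev E p₀ [] (updateBand I ⊤ s) := by
  obtain ⟨⟨h, ht⟩, hQ⟩ := whileLoop_induction (cond := fun s : LRAState V => s.Qupdate.Nonempty)
    (body := updateBody I ⊤)
    (fun s => UpdInv I Ev E s ∧ (I.target ∈ s.Qextend ∨ ∃ y ∈ s.Qupdate,
      Relation.ReflTransGen (Pred I (bandWeight I E)) y I.target)) (pendingCount I E)
    (fun s hs hc => updateBody_spec hEv hs.1 hs.2 hc) (s := s) ⟨hI, Or.inr ⟨y, hy, hyt⟩⟩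
  rw [Finset.not_nonempty_iff_eq_empty] at hQ
  change UpdInv I Ev E (updateBand I ⊤ s) at h
  change (updateBand I ⊤ s).Qupdate = ∅ at hQ
  refine ⟨⟨h.E_eq, h.result, hQ, h.Qrewire, h.Trewire⟩, h.le_key, fun x hx => ?_, h.ext_sub,
    fun q x hqx _ _ _ => ?_, fun x hx _ => h.final x hx, fun x hx => ?_, h.ext_ev, fun _ => ?_,
    fun x hx => ?_⟩
  · rw [(h.final x hx).key]; exact (h.final x hx).lt_top
  · have hx := (h.mem_T x).2 hqx.2.2
    exact ⟨hx, h.final x hx⟩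
  · have hx := (h.mem_T x).2 (hEvd x hx)
    exact ⟨hx, h.final x hx⟩
  · left
    rcases ht with ht | ⟨y, hy, -⟩
    · exact ht
    · change y ∈ (updateBand I ⊤ s).Qupdate at hy
      simp [hQ] at hy
  · rw [h.Qfrontier] at hx
    simp at hx

/-! ### Rewiring the band -/

@[simp] theorem setNode_self (s : LRAState V) (v : V) : s.setNode v (s.node v) = s := by
  simp [setNode]

theorem relax_spec {ω : V × V → ℝ≥0∞} (hω : IsWeight I ω) {s : LRAState V} {p v : V}
    (hp : IsFinal I ω Ev p (s.node p)) (hE : (p, v) ∈ I.edges) (hw : ω (p, v) < ∞)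
    (hv : IsTentative I ω v (s.node v)) :
    ∃ t, relax I v s p = s.setNode v t ∧ IsTentative I ω v t ∧ t.key ≤ (s.node v).key ∧
      t.key ≤ dist I ω p + ω (p, v) := by
  have hkey := key_childEntry hω hp.key hE hw
  by_cases h : (s.node v).key > (s.childEntry I p v).key
  · exact ⟨_, if_pos h, isTentative_childEntry hω hp hE hw, h.le, hkey.le⟩
  · refine ⟨s.node v, ?_, hv, le_rfl, ?_⟩
    · rw [setNode_self]; exact if_neg h
    · rw [← hkey]; exact not_lt.1 h

variable (I Ev) in
/-- The invariant of rewiring the band; the vertices `L` remain to be relaxed through `p`. -/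
structure RewInv (E : Finset (V × V)) (p : V) (L : List V) (s : LRAState V) : Prop where
  E_eq : s.E = E
  result : s.result = none
  Qupdate : s.Qupdate = ∅
  le_key : ∀ x, dist I (bandWeight I E) x ≤ (s.node x).key
  final : ∀ x ∈ s.T, IsFinal I (bandWeight I E) Ev x (s.node x)
  rew : ∀ x ∈ s.Qrewire, x ∉ s.T ∧ IsTentative I (bandWeight I E) x (s.node x)
  child : ∀ q x, Pred I (bandWeight I E) q x → q ∈ s.T → x ∉ s.T → (q = p → x ∉ L) →
    (s.node x).key ≤ dist I (bandWeight I E) x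
  cover : ∀ x, dist I (bandWeight I E) x < ∞ → x ∈ s.T ∨ x ∈ s.Qrewire
  ev : ∀ x ∈ Ev, x ∈ s.T
  ext : ∀ q ∈ s.Qextend, q ∈ s.T ∧ q ∉ Ev
  tgt : I.target ∈ s.T → I.target ∈ s.Qfrontier
  front : ∀ x ∈ s.Qfrontier, x = I.target ∧ x ∈ s.T

theorem RewInv.relax (hE : E ⊆ I.edges) {s : LRAState V} {p v : V} {L : List V}
    (h : RewInv I Ev E p (v :: L) s) (hp : p ∈ s.T) (hpt : p ≠ I.target) (hpv : (p, v) ∈ E)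
    (hv : v ∈ s.Qrewire) :
    RewInv I Ev E p L (relax I v s p) ∧ (relax I v s p).T = s.T ∧
      (relax I v s p).Qrewire = s.Qrewire := by
  have hω : IsWeight I (bandWeight I E) := isWeight_bandWeight E
  obtain ⟨t, heq, ht, hle, hlep⟩ := relax_spec hω (h.final p hp) (hE hpv)
    (bandWeight_lt_top.2 ⟨hpv, hpt⟩) (h.rew v hv).2
  have hvT := (h.rew v hv).1
  rw [heq]
  refine ⟨⟨h.E_eq, h.result, h.Qupdate, fun x => ?_, fun x hx => ?_,
    fun x hx => ⟨(h.rew x hx).1, ?_⟩, fun q x hqx hq hx hL => ?_, h.cover, h.ev, h.ext, h.tgt, h.front⟩, rfl, rfl⟩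
  · by_cases hxv : x = v
    · subst hxv; simpa [setNode] using ht.dist_le
    · simpa [setNode, hxv] using h.le_key x
  · have hxv : x ≠ v := fun h => hvT (h ▸ hx)
    simpa [setNode, hxv] using h.final x hx
  · by_cases hxv : x = v
    · subst hxv; simpa [setNode] using ht
    · simpa [setNode, hxv] using (h.rew x hx).2
  · by_cases hxv : x = v
    · subst hxv
      simp only [setNode, Function.update_self]
      by_cases hqp : q = p
      · subst hqp; rw [hqx.2.1]; exact hlep
      · exact hle.trans (h.child q x hqx hq hx (fun h => absurd h hqp))
    · simpa [setNode, hxv] using h.child q x hqx hq hx (fun hqp => by simp [hxv, hL hqp])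

/-- Dijkstra's algorithm on the detached vertices, with the whole current tree as settled set. A
popped vertex never returns to the queue, so the size of the queue is a measure. -/
theorem rewireBody_spec (hE : E ⊆ I.edges) (hEv : EvOK I Ev E) {s : LRAState V} {p₀ : V}
    (h : RewInv I Ev E p₀ [] s) (hne : s.Qrewire.Nonempty) :
    RewInv I Ev E p₀ [] (rewireBody I ⊤ s) ∧ (rewireBody I ⊤ s).Qrewire.card < s.Qrewire.card := by
  have hω : IsWeight I (bandWeight I E) := isWeight_bandWeight E
  set p := s.top I s.Qrewire with hp
  have hpQ : p ∈ s.Qrewire := top_mem hne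
  obtain ⟨hpT, hpt⟩ := h.rew p hpQ
  have hpk : dist I (bandWeight I E) p < ∞ → (s.node p).key = dist I (bandWeight I E) p :=
    fun hpd => (dijkstra_min hω (S := s.T) (Q := s.Qrewire) (key := fun x => (s.node x).key)
      (p := p) (Or.inl (h.ev _ hEv.source))
      (fun x y hx hxy hy => ⟨(h.cover y hxy.2.2).resolve_left hy,
        h.child x y hxy hx hy (by simp)⟩)
      (h.le_key p) (fun q hq => key_top_le hq) hpT hpd).1
  have hcard : (s.Qrewire.erase p).card < s.Qrewire.card := Finset.card_erase_lt_of_mem hpQ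
  set s₁ : LRAState V := { s with Qrewire := s.Qrewire.erase p } with hs₁
  by_cases hpar : (s.node p).parent = none
  · have heq : rewireBody I ⊤ s = s₁ := by
      simp only [rewireBody, ← hp]
      exact if_pos hpar
    have hkey : (s.node p).key = ∞ := by
      rcases hpt with hpt | ⟨q, hq, -⟩
      · exact hpt.2
      · rw [hpar] at hq; simp at hq
    rw [heq]
    refine ⟨⟨h.E_eq, h.result, h.Qupdate, h.le_key, h.final,
      fun x hx => h.rew x (Finset.mem_of_mem_erase hx),
      fun q x hqx hq hx _ => h.child q x hqx hq hx (by simp), fun x hx => ?_, h.ev, h.ext, h.tgt,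
      h.front⟩, hcard⟩
    rcases h.cover x hx with hx' | hx'
    · exact Or.inl hx'
    · refine Or.inr (Finset.mem_erase.2 ⟨?_, hx'⟩)
      -- The popped vertex has an unset entry of key `∞`, whereas a finite distance would be its
      -- key.
      rintro rfl
      have := hpk hx
      rw [hkey] at this
      exact absurd hx (not_lt.2 this.le)
  · have hpd : dist I (bandWeight I E) p < ∞ := by
      refine (h.le_key p).trans_lt ?_
      rcases hpt with hpt | ⟨q, -, -, h₁, h₂, h₃, -⟩
      · exact absurd hpt.1 hpar
      · rw [h₃]; exact ENNReal.add_lt_top.2 ⟨h₂, h₁⟩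
    have hpEv : p ∉ Ev := fun hp => hpT (h.ev p hp)
    have hpf : IsFinal I (bandWeight I E) Ev p (s.node p) :=
      hpt.isFinal hω (hpk hpd).le hpd hpEv
    have hfin : ∀ x ∈ insert p s.T, IsFinal I (bandWeight I E) Ev x (s.node x) := by
      intro x hx
      rcases Finset.mem_insert.1 hx with rfl | hx
      · exact hpf
      · exact h.final x hx
    have hrew : ∀ x ∈ s.Qrewire.erase p,
        x ∉ insert p s.T ∧ IsTentative I (bandWeight I E) x (s.node x) := by
      intro x hx
      rw [Finset.mem_erase] at hx
      exact ⟨by simp [hx.1, (h.rew x hx.2).1], (h.rew x hx.2).2⟩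
    have hcov : ∀ x, dist I (bandWeight I E) x < ∞ → x ∈ insert p s.T ∨ x ∈ s.Qrewire.erase p := by
      intro x hx
      have := h.cover x hx
      simp only [Finset.mem_insert, Finset.mem_erase]
      tauto
    have hev : ∀ x ∈ Ev, x ∈ insert p s.T := fun x hx => by simp [h.ev x hx]
    by_cases htg : p = I.target
    · have heq : rewireBody I ⊤ s =
          { s₁ with T := insert p s.T, Qfrontier := insert p s.Qfrontier } := by
        simp only [rewireBody, ← hp]
        rw [if_neg hpar, if_pos (Or.inr htg)]
      rw [heq]
      refine ⟨⟨h.E_eq, h.result, h.Qupdate, h.le_key, hfin, hrew, fun q x hqx hq hx _ => ?_, hcov,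
        hev, fun q hq => ⟨by simp [(h.ext q hq).1], (h.ext q hq).2⟩, fun _ => by simp [htg],
        fun x hx => ?_⟩, hcard⟩
      · have hq' : q ∈ s.T := (Finset.mem_insert.1 hq).resolve_left fun h =>
          hqx.mem_band.2 (h.trans htg)
        exact h.child q x hqx hq' (fun h => hx (by simp [h])) (by simp)
      · rcases Finset.mem_insert.1 hx with rfl | hx
        · exact ⟨htg, by simp⟩
        · exact ⟨(h.front x hx).1, by simp [(h.front x hx).2]⟩
    · set s₃ : LRAState V := { s₁ with T := insert p s.T, Qextend := insert p s.Qextend } with hs₃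
      set L := ((s.Qrewire.erase p).filter fun v => (p, v) ∈ s.E).toList with hL
      have heq : rewireBody I ⊤ s = L.foldl (fun s v => LRAState.relax I v s p) s₃ := by
        have hb : ¬ ((s.node p).b = ⊤ ∨ p = I.target) := by simp [hpf.b_ne_top, htg]
        have hb' : (s.node p).b < ⊤ := lt_top_iff_ne_top.2 hpf.b_ne_top
        simp only [rewireBody, ← hp]
        rw [if_neg hpar, if_neg hb, if_pos hb']
      have hLmem : ∀ v, v ∈ L ↔ v ∈ s.Qrewire.erase p ∧ (p, v) ∈ E := by
        intro v
        rw [hL, Finset.mem_toList, Finset.mem_filter, h.E_eq]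
      have h₃ : RewInv I Ev E p L s₃ := by
        refine ⟨h.E_eq, h.result, h.Qupdate, h.le_key, hfin, hrew, fun q x hqx hq hx hqL => ?_,
          hcov, hev, fun q hq => ?_, fun ht => ?_,
          fun x hx => ⟨(h.front x hx).1, by simp [hs₃, (h.front x hx).2]⟩⟩
        · have hqp : q ≠ p := fun hqp => hqL hqp ((hLmem x).2
            ⟨(hcov x hqx.2.2).resolve_left hx, hqp ▸ hqx.mem_band.1⟩)
          exact h.child q x hqx ((Finset.mem_insert.1 hq).resolve_left hqp)
            (fun h => hx (by simp [hs₃, h])) (by simp)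
        · rcases Finset.mem_insert.1 hq with rfl | hq
          · exact ⟨by simp [hs₃], hpEv⟩
          · exact ⟨by simp [hs₃, (h.ext q hq).1], (h.ext q hq).2⟩
        · exact h.tgt ((Finset.mem_insert.1 ht).resolve_left (Ne.symm htg))
      obtain ⟨h₄, -, h₆, -⟩ := foldl_induction (fun s v => LRAState.relax I v s p)
        (fun L s' => RewInv I Ev E p L s' ∧ p ∈ s'.T ∧ s'.Qrewire = s₃.Qrewire ∧
          ∀ v ∈ L, v ∈ s₃.Qrewire ∧ (p, v) ∈ E)
        (fun v L s' ⟨h₁, h₂, h₃, h₄⟩ => by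
          obtain ⟨h₅, h₆, h₇⟩ := h₁.relax hE h₂ htg (h₄ v (by simp)).2
            (h₃ ▸ (h₄ v (by simp)).1)
          exact ⟨h₅, h₆ ▸ h₂, h₇.trans h₃, fun x hx => h₄ x (by simp [hx])⟩)
        L s₃ ⟨h₃, by simp [hs₃], rfl, fun v hv => (hLmem v).1 hv⟩
      rw [← heq] at h₄ h₆
      refine ⟨{ h₄ with child := fun q x hqx hq hx _ => h₄.child q x hqx hq hx (by simp) }, ?_⟩
      rw [h₆]
      exact hcard

theorem extInv_rewire_loop (hE : E ⊆ I.edges) (hEv : EvOK I Ev E) {s : LRAState V} {p₀ : V}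
    (hI : RewInv I Ev E p₀ [] s) :
    ExtInv I Ev E p₀ [] { whileLoop (fun s => s.Qrewire.Nonempty) (rewireBody I ⊤) s with
      Trewire := ∅ } := by
  obtain ⟨h, hQ⟩ := whileLoop_induction (cond := fun s : LRAState V => s.Qrewire.Nonempty)
    (body := rewireBody I ⊤) (RewInv I Ev E p₀ []) (fun s => s.Qrewire.card)
    (fun s hs hc => rewireBody_spec hE hEv hs hc) hI
  rw [Finset.not_nonempty_iff_eq_empty] at hQ
  set s' := whileLoop (fun s => s.Qrewire.Nonempty) (rewireBody I ⊤) s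
  refine ⟨⟨h.E_eq, h.result, h.Qupdate, hQ, rfl⟩, h.le_key, fun x hx => ?_,
    fun q hq => (h.ext q hq).1, fun q x hqx _ _ _ => ?_, fun x hx _ => h.final x hx,
    fun x hx => ⟨h.ev x hx, h.final x (h.ev x hx)⟩,
    fun q hq x hqx hx => (h.ext q hq).2 (hEv.closed _ _ hqx hx), fun ht => Or.inr (h.tgt ht),
    h.front⟩
  · change (s'.node x).key < ∞
    rw [(h.final x hx).key]; exact (h.final x hx).lt_top
  · have hx : x ∈ s'.T := (h.cover x hqx.2.2).resolve_right (by simp [hQ])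
    exact ⟨hx, h.final x hx⟩

/-- The invariant of detaching the vertices of the subtree `R`, of which those in `L` remain, in
the state `s₀`. -/
structure ResetInv (I : Input V) (E : Finset (V × V)) (s₀ : LRAState V) (R : Finset V)
    (L : List V) (s : LRAState V) : Prop where
  E_eq : s.E = E
  result : s.result = none
  Qupdate : s.Qupdate = ∅
  Qextend : s.Qextend = ∅
  Qfrontier : s.Qfrontier = ∅
  Trewire : s.Trewire = R
  T_eq : s.T = s₀.T \ s.Qrewire
  sub : s.Qrewire ⊆ R
  cover : ∀ x ∈ R, x ∈ L ∨ x ∈ s.Qrewire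
  L_sub : ∀ x ∈ L, x ∈ R
  node_eq : ∀ x ∉ R, s.node x = s₀.node x
  rew : ∀ x ∈ s.Qrewire, IsTentative I (bandWeight I E) x (s.node x)
  child : ∀ x ∈ s.Qrewire, ∀ q ∈ s₀.T, q ∉ R → Pred I (bandWeight I E) q x →
    (s.node x).key ≤ dist I (bandWeight I E) x

/-- Only parents outside `R` are admitted: vertices of `R` not yet reset are still in the tree, with
entries that belong to the old graph. -/
theorem ResetInv.step (hE : E ⊆ I.edges) {s₀ s : LRAState V} {R : Finset V} {v : V} {L : List V}
    (hfin : ∀ x ∈ s₀.T, x ∉ R → IsFinal I (bandWeight I E) Ev x (s₀.node x))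
    (h : ResetInv I E s₀ R (v :: L) s) : ResetInv I E s₀ R L (rewireReset I ⊤ s v) := by
  have hω : IsWeight I (bandWeight I E) := isWeight_bandWeight E
  have hvR : v ∈ R := h.L_sub v (by simp)
  set s₁ : LRAState V :=
    { s.setNode v Entry.unset with T := s.T.erase v, Qfrontier := s.Qfrontier.erase v } with hs₁
  set parents := s₁.T.filter fun p => (p, v) ∈ s₁.E ∧ (s₁.node p).b < ⊤ ∧
    p ∉ s₁.Trewire ∧ p ∉ s₁.Qextend ∧ p ≠ I.target with hpar
  have hmem : ∀ q, q ∈ parents ↔ q ∈ s₀.T ∧ q ∉ R ∧ (q, v) ∈ E ∧ q ≠ I.target := by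
    intro q
    simp only [hpar, Finset.mem_filter, hs₁, setNode, h.T_eq, h.E_eq, h.Trewire, h.Qextend]
    constructor
    · rintro ⟨h₁, h₂, -, h₃, -, h₄⟩
      simp at h₁
      exact ⟨h₁.2.1, h₃, h₂, h₄⟩
    · rintro ⟨h₁, h₂, h₃, h₄⟩
      have hqv : q ≠ v := fun h => h₂ (h ▸ hvR)
      have hqQ : q ∉ s.Qrewire := fun hh => h₂ (h.sub hh)
      refine ⟨by simp [hqv, h₁, hqQ], h₃, ?_, h₂, by simp, h₄⟩
      rw [Function.update_of_ne hqv, h.node_eq q h₂]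
      exact lt_top_iff_ne_top.2 (hfin q h₁ h₂).b_ne_top
  -- Relaxing `v` changes only its own entry, so every intermediate state is `s₁` with one entry
  -- `t`, whose key is bounded through each parent already tried.
  obtain ⟨t, ht, htent, -, hle⟩ := foldl_induction (LRAState.relax I v)
    (fun M s' => ∃ t, s' = s₁.setNode v t ∧ IsTentative I (bandWeight I E) v t ∧
      (∀ q ∈ M, q ∈ parents) ∧
      ∀ q ∈ parents, q ∈ M ∨ t.key ≤ dist I (bandWeight I E) q + bandWeight I E (q, v))
    (by
      rintro q M s' ⟨t, rfl, htent, hM, hle⟩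
      obtain ⟨hqT, hqR, hqE, hqt⟩ := (hmem q).1 (hM q (by simp))
      have hqv : q ≠ v := fun h => hqR (h ▸ hvR)
      have hqn : (s₁.setNode v t).node q = s₀.node q := by
        simp [setNode, hs₁, hqv, h.node_eq q hqR]
      obtain ⟨t', h₁, h₂, h₃, h₄⟩ := relax_spec hω (s := s₁.setNode v t) (p := q) (v := v)
        (Ev := Ev) (by rw [hqn]; exact hfin q hqT hqR) (hE hqE)
        (bandWeight_lt_top.2 ⟨hqE, hqt⟩) (by simpa [setNode] using htent)
      refine ⟨t', by rw [h₁]; simp [setNode], h₂, fun x hx => hM x (by simp [hx]), fun x hx => ?_⟩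
      rcases hle x hx with h | h
      · rcases List.mem_cons.1 h with rfl | h
        · exact Or.inr h₄
        · exact Or.inl h
      · exact Or.inr ((h₃.trans (by simp [setNode])).trans h))
    parents.toList s₁
    ⟨Entry.unset, by simp [hs₁, setNode], Or.inl ⟨rfl, by simp [Entry.unset, Entry.key]⟩,
      by simp, fun q hq => Or.inl (by simpa using hq)⟩
  have heq : rewireReset I ⊤ s v = { s₁.setNode v t with Qrewire := insert v s.Qrewire } := by
    have : rewireReset I ⊤ s v = { parents.toList.foldl (LRAState.relax I v) s₁ with
      Qrewire := insert v (parents.toList.foldl (LRAState.relax I v) s₁).Qrewire } := rfl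
    rw [this, ht]
    rfl
  have hnode : (rewireReset I ⊤ s v).node = Function.update s.node v t := by
    rw [heq]; simp [setNode, hs₁]
  have hQ : (rewireReset I ⊤ s v).Qrewire = insert v s.Qrewire := by rw [heq]
  refine ⟨by rw [heq]; exact h.E_eq, by rw [heq]; exact h.result, by rw [heq]; exact h.Qupdate,
    by rw [heq]; exact h.Qextend, ?_, by rw [heq]; exact h.Trewire, ?_, ?_, fun x hx => ?_,
    fun x hx => h.L_sub x (by simp [hx]), fun x hx => ?_, fun x hx => ?_,
    fun x hx q hq hqR hqx => ?_⟩
  · rw [heq]; simp [setNode, hs₁, h.Qfrontier]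
  · rw [hQ, heq]
    simp only [setNode, hs₁, h.T_eq]
    ext x; simp; tauto
  · rw [hQ]; exact Finset.insert_subset hvR h.sub
  · rw [hQ]
    have := h.cover x hx
    simp at this ⊢
    tauto
  · have hxv : x ≠ v := fun h => hx (h ▸ hvR)
    rw [hnode, Function.update_of_ne hxv, h.node_eq x hx]
  · rw [hnode]
    rw [hQ] at hx
    by_cases hxv : x = v
    · subst hxv; simpa using htent
    · rw [Function.update_of_ne hxv]
      exact h.rew x ((Finset.mem_insert.1 hx).resolve_left hxv)
  · rw [hnode]
    rw [hQ] at hx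
    by_cases hxv : x = v
    · subst hxv
      rw [Function.update_self, hqx.2.1]
      exact (hle q ((hmem q).2 ⟨hq, hqR, hqx.mem_band⟩)).resolve_left (by simp)
    · rw [Function.update_of_ne hxv]
      exact h.child x ((Finset.mem_insert.1 hx).resolve_left hxv) q hq hqR hqx

/-! ### Deleting an edge in collision -/

theorem bandWeight_erase_le (e f : V × V) : bandWeight I E f ≤ bandWeight I (E.erase e) f := by
  unfold bandWeight
  split_ifs with h₁ h₂ <;> simp_all

theorem bandWeight_erase_of_ne {e f : V × V} (h : f ≠ e) :
    bandWeight I (E.erase e) f = bandWeight I E f := by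
  simp [bandWeight, h]

/-- Removing an edge `e` does not change the distance of a vertex that is not a descendant of the
head of `e`. -/
theorem dist_erase {e : V × V} {x : V} (hx : dist I (bandWeight I E) x < ∞)
    (hne : ¬ Relation.ReflTransGen (Pred I (bandWeight I E)) e.2 x) :
    dist I (bandWeight I (E.erase e)) x = dist I (bandWeight I E) x := by
  refine le_antisymm ?_ (dist_mono (fun f _ => bandWeight_erase_le e f) x)
  revert hne
  refine dist_induction (motive := fun x =>
    ¬ Relation.ReflTransGen (Pred I (bandWeight I E)) e.2 x →
    dist I (bandWeight I (E.erase e)) x ≤ dist I (bandWeight I E) x) (by simp) ?_ hx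
  intro p v hpv ih hne
  have hpe : (p, v) ≠ e := by rintro rfl; exact hne .refl
  rw [hpv.2.1, ← bandWeight_erase_of_ne hpe]
  exact (dist_le_add hpv.1).trans (add_le_add_left (ih fun h => hne (h.tail hpv)) _)

theorem pred_erase {e : V × V} {p x : V} (h : Pred I (bandWeight I E) p x)
    (hne : ¬ Relation.ReflTransGen (Pred I (bandWeight I E)) e.2 x) :
    Pred I (bandWeight I (E.erase e)) p x := by
  have hpe : (p, x) ≠ e := by rintro rfl; exact hne .refl
  have hx := dist_erase h.2.2 hne
  refine ⟨h.1, ?_, hx ▸ h.2.2⟩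
  rw [hx, dist_erase h.dist_lt_top (fun h' => hne (h'.tail h)), bandWeight_erase_of_ne hpe, h.2.1]

/-- The old predecessor survives the deletion, and after it there is again only one. -/
theorem pred_erase_iff {e : V × V} {p x : V} (hx : dist I (bandWeight I E) x < ∞)
    (hne : ¬ Relation.ReflTransGen (Pred I (bandWeight I E)) e.2 x) :
    Pred I (bandWeight I (E.erase e)) p x ↔ Pred I (bandWeight I E) p x := by
  refine ⟨fun h => ?_, fun h => pred_erase h hne⟩
  have hs : x ≠ I.source := by
    rintro rfl
    exact not_pred_source (isWeight_bandWeight _) p h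
  obtain ⟨q, hq⟩ := exists_pred hx hs
  rwa [h.unique (isWeight_bandWeight _) (pred_erase hq hne)]

theorem not_reflTransGen_of_mem_ev (hEv : EvOK I Ev E) {v x : V} (hv : v ∉ Ev) (hx : x ∈ Ev) :
    ¬ Relation.ReflTransGen (Pred I (bandWeight I E)) v x := by
  intro h
  have aux : ∀ y, Relation.ReflTransGen (Pred I (bandWeight I E)) y x → y ∈ Ev := by
    intro y hy
    induction hy using Relation.ReflTransGen.head_induction_on with
    | refl => exact hx
    | head h _ ih => exact hEv.closed _ _ h ih
  exact hv (aux v h)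

theorem evOK_erase (hEv : EvOK I Ev E) (hEvd : ∀ x ∈ Ev, dist I (bandWeight I E) x < ∞)
    {e : V × V} (he : e.2 ∉ Ev) : EvOK I Ev (E.erase e) :=
  ⟨hEv.source, fun p x h hx => hEv.closed p x
    ((pred_erase_iff (hEvd x hx) (not_reflTransGen_of_mem_ev hEv he hx)).1 h) hx⟩

/-- The detached subtree is exactly the set of descendants of `e.2`; all other entries stay final
for the smaller edge set. The target is a descendant, so it is detached and can reach the frontier
only by being rewired. -/
theorem extInv_rewireBand (hE : E ⊆ I.edges) (hEv : EvOK I Ev E)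
    (hEvd : ∀ x ∈ Ev, dist I (bandWeight I E) x < ∞) {s : LRAState V} (h : Stable I Ev E s)
    {e : V × V} (hev : e.2 ∉ Ev)
    (het : Relation.ReflTransGen (Pred I (bandWeight I E)) e.2 I.target) (p₀ : V) :
    ExtInv I Ev (E.erase e) p₀ [] (rewireBand I ⊤
      { s with Qfrontier := ∅, E := E.erase e, Trewire := s.subtree e.2 }) := by
  set ω := bandWeight I E with hωd
  set ω' := bandWeight I (E.erase e) with hωd'
  have hE' : E.erase e ⊆ I.edges := (Finset.erase_subset _ _).trans hE
  have hEv' := evOK_erase hEv hEvd hev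
  set R := s.subtree e.2 with hR
  set s₀ : LRAState V := { s with Qfrontier := ∅, E := E.erase e, Trewire := R } with hs₀
  have hRmem : ∀ x ∈ s.T, x ∉ R → ¬ Relation.ReflTransGen (Pred I ω) e.2 x := by
    intro x hx hxR hr
    refine hxR (mem_subtree.2 ⟨hx, ?_⟩)
    clear hxR
    induction hr with
    | refl => exact .refl
    | @tail b c _ hbc ih =>
      exact .head (((h.final c hx).parent b).2 hbc) (ih ((h.mem_T b).2 hbc.dist_lt_top))
  have hRR : ∀ x ∈ R, x ∈ s.T ∧ Relation.ReflTransGen (Pred I ω) e.2 x := by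
    intro x hx
    obtain ⟨h₁, h₂⟩ := mem_subtree.1 hx
    refine ⟨h₁, reflTransGen_pred_of_parent (Ev := Ev) (fun y hy => h.final y ?_) h₂⟩
    exact (h.mem_T y).2 ((dist_le_of_reflTransGen hy).trans_lt ((h.mem_T x).1 h₁))
  have hfin : ∀ x ∈ s.T, x ∉ R → IsFinal I ω' Ev x (s.node x) := by
    intro x hx hxR
    have hd := (h.mem_T x).1 hx
    have hf := h.final x hx
    have hdist := dist_erase hd (hRmem x hx hxR)
    exact ⟨fun p => (hf.parent p).trans (pred_erase_iff hd (hRmem x hx hxR)).symm,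
      hf.key.trans hdist.symm, hdist ▸ hd, hf.b_ne_top, hf.b_eq_zero, hf.l_eq_zero⟩
  have hres := foldl_induction (rewireReset I ⊤) (fun L s' => ResetInv I (E.erase e) s₀ R L s')
    (fun v L s' h' => h'.step (Ev := Ev) hE' hfin) R.toList s₀
    ⟨rfl, h.quiet.result, h.quiet.Qupdate, h.Qextend, rfl, rfl,
      by simp [hs₀, h.quiet.Qrewire], by simp [hs₀, h.quiet.Qrewire],
      fun x hx => Or.inl (by simpa using hx), fun x hx => by simpa using hx, fun _ _ => rfl,
      by simp [hs₀, h.quiet.Qrewire], by simp [hs₀, h.quiet.Qrewire]⟩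
  refine extInv_rewire_loop (s := R.toList.foldl (rewireReset I ⊤) s₀) hE' hEv' ?_
  set s₁ := R.toList.foldl (rewireReset I ⊤) s₀
  have hQR : s₁.Qrewire = R := subset_antisymm hres.sub fun x hx =>
    (hres.cover x hx).resolve_left (by simp)
  have hT : ∀ x, x ∈ s₁.T ↔ x ∈ s.T ∧ x ∉ R := by
    intro x
    rw [hres.T_eq, hQR]
    simp [hs₀]
  have hnode : ∀ x ∉ R, s₁.node x = s.node x := hres.node_eq
  refine ⟨hres.E_eq, hres.result, hres.Qupdate, fun x => ?_, fun x hx => ?_, fun x hx => ?_,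
    fun q x hqx hq hx _ => ?_, fun x hx => ?_, fun x hx => ?_, by simp [hres.Qextend], fun ht => ?_,
    by simp [hres.Qfrontier]⟩
  · by_cases hxR : x ∈ R
    · exact (hres.rew x (hQR ▸ hxR)).dist_le
    · rw [hnode x hxR]
      by_cases hxT : x ∈ s.T
      · exact (hfin x hxT hxR).key.ge
      · have h₁ : ¬ dist I ω x < ∞ := fun hh => hxT ((h.mem_T x).2 hh)
        exact le_top.trans ((not_lt.1 h₁).trans (h.le_key x))
  · obtain ⟨h₁, h₂⟩ := (hT x).1 hx
    rw [hnode x h₂]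
    exact hfin x h₁ h₂
  · exact ⟨fun hxT => ((hT x).1 hxT).2 (hQR ▸ hx), hres.rew x hx⟩
  · have hxd : x ∈ s.T := (h.mem_T x).2
      ((dist_mono (fun f _ => bandWeight_erase_le e f) x).trans_lt hqx.2.2)
    have hxR : x ∈ R := by
      by_contra hxR
      exact hx ((hT x).2 ⟨hxd, hxR⟩)
    obtain ⟨h₁, h₂⟩ := (hT q).1 hq
    exact hres.child x (hQR ▸ hxR) q h₁ h₂ hqx
  · have hxd : x ∈ s.T := (h.mem_T x).2
      ((dist_mono (fun f _ => bandWeight_erase_le e f) x).trans_lt hx)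
    rw [hT, hQR]
    tauto
  · rw [hT]
    refine ⟨(h.mem_T x).2 (hEvd x hx), fun hxR => ?_⟩
    exact not_reflTransGen_of_mem_ev hEv hev hx (hRR x hxR).2
  · obtain ⟨h₁, h₂⟩ := (hT _).1 ht
    exact absurd het (hRmem _ h₁ h₂)

end LRAState

namespace LRAState

variable {V : Type u} [Fintype V] [DecidableEq V] {I : Input V} {Ev : Set V}
  {E : Finset (V × V)} {w : V × V → ℝ≥0∞} {known : V × V → Option ℝ≥0∞}

/-! ### Paths in the search tree -/

/-- Final entries point to predecessors, so the pointers retrace `P`; `n` steps list up to `n + 1`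
vertices. -/
theorem backtrack_eq {ω : V × V → ℝ≥0∞} (hω : IsWeight I ω) {s : LRAState V} {x : V} {P : List V}
    (hP : IsShortestPath I ω x P) (hfin : ∀ y ∈ P, IsFinal I ω Ev y (s.node y)) (n : ℕ)
    (hn : P.length ≤ n + 1) : s.backtrack n x = P := by
  induction P using List.reverseRecOn generalizing x n with
  | nil => exact absurd rfl hP.1.ne_nil
  | append_singleton A y ih =>
    obtain rfl : y = x := by simpa [IsPath] using hP.1.2.2
    rcases List.eq_nil_or_concat A with rfl | ⟨A', p, rfl⟩
    · obtain rfl : y = I.source := by simpa [IsPath] using hP.1.2.1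
      have hpar : (s.node I.source).parent = none := by
        cases h : (s.node I.source).parent with
        | none => rfl
        | some q =>
          exact absurd (((hfin I.source (by simp)).parent q).1 h) (not_pred_source hω q)
      cases n <;> simp [backtrack, hpar]
    · have hP' : IsShortestPath I ω y (A' ++ p :: y :: []) := by simpa using hP
      have hpar : (s.node y).parent = some p := ((hfin y (by simp)).parent p).2 hP'.pred
      cases n with
      | zero => simp at hn
      | succ n =>
        have := ih (x := p) (by simpa using hP'.initialPart)
          (fun z hz => hfin z (List.mem_append_left _ hz)) n (by simpa using hn)
        simp [backtrack, hpar, this]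

theorem dist_lt_top_of_mem {ω : V × V → ℝ≥0∞} {x y : V} {P : List V}
    (hP : IsShortestPath I ω x P) (hy : y ∈ P) : dist I ω y < ∞ := by
  obtain ⟨A, B, rfl⟩ := List.append_of_mem hy
  exact hP.initialPart.dist_lt

theorem reflTransGen_of_mem {ω : V × V → ℝ≥0∞} {x y : V} {P : List V}
    (hP : IsShortestPath I ω x P) (hy : y ∈ P) : Relation.ReflTransGen (Pred I ω) y x := by
  obtain ⟨A, B, rfl⟩ := List.append_of_mem hy
  have h := (List.isChain_split.1 hP.isChain_pred).2
  have hl : (y :: B).getLast (by simp) = x := by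
    have := hP.1.2.2
    rw [List.getLast?_append_cons, List.getLast?_eq_some_getLast (by simp)] at this
    simpa using this
  exact List.relationReflTransGen_of_exists_isChain_cons B h hl

variable (I Ev) in
/-- The entries of the nodes describe the tree of shortest paths. -/
structure Shaped (E : Finset (V × V)) (s : LRAState V) : Prop where
  mem_T : ∀ x, x ∈ s.T ↔ dist I (bandWeight I E) x < ∞
  final : ∀ x ∈ s.T, IsFinal I (bandWeight I E) Ev x (s.node x)

theorem Shaped.pathTo {s : LRAState V} (h : Shaped I Ev E s) {x : V} {P : List V}
    (hP : IsShortestPath I (bandWeight I E) x P) : s.pathTo x = P :=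
  backtrack_eq (isWeight_bandWeight E) hP
    (fun y hy => h.final y ((h.mem_T y).2 (dist_lt_top_of_mem hP hy))) _
    ((hP.nodup (isWeight_bandWeight E)).length_le_card.trans (Nat.le_succ _))

/-! ### The relation with the values recorded by LazySP -/

/-- The edges `E` and the vertices `Ev` reflect the values of the evaluated edges. -/
structure Reflects (I : Input V) (known : V × V → Option ℝ≥0∞) (E : Finset (V × V))
    (Ev : Set V) : Prop where
  weight : IsWeight I (currentWeight I known)
  sub : E ⊆ I.edges
  mem_E : ∀ e ∈ I.edges, e ∈ E ↔ known e ≠ some ∞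
  evOK : EvOK I Ev E
  lt_top : ∀ x ∈ Ev, dist I (bandWeight I E) x < ∞
  near : ∀ x ∈ Ev, dist I (bandWeight I E) x ≤ dist I (bandWeight I E) I.target
  tree : ∀ p x, known (p, x) ≠ none → (p, x) ∈ E → x ∈ Ev ∧ Pred I (bandWeight I E) p x
  known_of_ev : ∀ p x, Pred I (bandWeight I E) p x → x ∈ Ev → known (p, x) ≠ none

theorem Reflects.bandWeight_eq (h : Reflects I known E Ev) {e : V × V} (he : e ∈ I.edges)
    (ht : e.1 ≠ I.target) : bandWeight I E e = currentWeight I known e := by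
  by_cases hE : e ∈ E
  · have hk := (h.mem_E e he).1 hE
    have hlt : currentWeight I known e < ∞ := by
      unfold currentWeight
      cases hke : known e with
      | none => simp
      | some y =>
        rw [hke] at hk
        simpa [lt_top_iff_ne_top] using hk
    rw [h.weight.eq_lazyW he hlt]
    simp [bandWeight, hE, ht]
  · have hk : known e = some ∞ := by
      by_contra hk
      exact hE ((h.mem_E e he).2 hk)
    simp [bandWeight, hE, currentWeight, hk]

theorem Reflects.le_bandWeight (h : Reflects I known E Ev) {e : V × V} (he : e ∈ I.edges) :
    currentWeight I known e ≤ bandWeight I E e := by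
  by_cases ht : e.1 = I.target
  · simp [bandWeight, ht]
  · exact (h.bandWeight_eq he ht).ge

/-- A path that uses an edge out of the target has an initial part ending at the target; on any
other path both weights agree. Hence shortest paths to vertices no farther than the target are the
same for both. -/
theorem Reflects.dist_le_cost (h : Reflects I known E Ev) {x : V} {Q : List V}
    (hQ : IsPath I.edges I.source x Q) :
    dist I (bandWeight I E) x ≤ cost (currentWeight I known) Q ∨
      dist I (bandWeight I E) I.target ≤ cost (currentWeight I known) Q := by
  cases hf : (pathEdges Q).find? (fun e => decide (e.1 = I.target)) with
  | none =>
    left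
    rw [List.find?_eq_none] at hf
    refine (LazySearch.dist_le_cost hQ).trans (cost_mono fun e he => ?_)
    exact (h.bandWeight_eq (mem_edges_of_isChain hQ.1 he) (by simpa using hf e he)).le
  | some e =>
    right
    obtain ⟨he, A, B, rfl, hA⟩ := exists_split_of_find? hf
    rw [decide_eq_true_eq] at he
    have hQ' := (isPath_append_cons.1 hQ).1
    rw [cost_append_cons, ← he]
    refine le_trans ((LazySearch.dist_le_cost hQ').trans (cost_mono fun e he => ?_)) le_self_add
    exact (h.bandWeight_eq (mem_edges_of_isChain hQ'.1 he) (by simpa using hA e he)).le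

theorem Reflects.isShortestPath (h : Reflects I known E Ev) {x : V} {P : List V}
    (hP : IsShortestPath I (bandWeight I E) x P)
    (hx : dist I (bandWeight I E) x ≤ dist I (bandWeight I E) I.target) :
    IsShortestPath I (currentWeight I known) x P := by
  have hle : cost (currentWeight I known) P ≤ dist I (bandWeight I E) x := by
    rw [← hP.cost_eq]
    exact cost_mono fun e he => h.le_bandWeight (mem_edges_of_isChain hP.1.1 he)
  refine ⟨hP.1, hle.trans_lt hP.dist_lt, fun Q hQ => hle.trans ?_⟩
  rcases h.dist_le_cost hQ with h' | h'
  · exact h'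
  · exact hx.trans h'

/-- On tree edges, being unevaluated for LazySP means leading to a node of nonzero budget for LRA*;
this makes both select the same edge. -/
theorem Reflects.known_iff (h : Reflects I known E Ev) {p x : V}
    (hpx : Pred I (bandWeight I E) p x) : known (p, x) = none ↔ x ∉ Ev := by
  refine ⟨fun hk hx => h.known_of_ev p x hpx hx hk, fun hx => ?_⟩
  by_contra hk
  exact hx (h.tree p x hk hpx.mem_band.1).1

theorem pred_of_mem_pathEdges {ω : V × V → ℝ≥0∞} {x : V} {P : List V}
    (hP : IsShortestPath I ω x P) {e : V × V} (he : e ∈ pathEdges P) : Pred I ω e.1 e.2 := by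
  obtain ⟨L, M, hL⟩ := List.append_of_mem he
  obtain ⟨A, B, rfl, -⟩ := exists_append_of_mem_pathEdges hL
  exact hP.pred

/-- The evaluated part of the search tree. -/
def evaluatedTree (s : LRAState V) : Tree V where
  verts := {x | x ∈ s.T ∧ (s.node x).b = 0}
  parent x := (s.node x).parent

/-- The paths in the tree are shortest only for `bandWeight`; `near` transfers them to the current
weights, and since all their edges are evaluated, to the true weights. -/
theorem isShortestPathTree_evaluatedTree (hw : IsWeight I w) (hag : Agrees I w known)
    (h : Reflects I known E Ev) {s : LRAState V} (hs : Shaped I Ev E s) :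
    IsShortestPathTree I w s.evaluatedTree := by
  have hω : IsWeight I (bandWeight I E) := isWeight_bandWeight E
  have hmem : ∀ x ∈ Ev, x ∈ s.evaluatedTree.verts := fun x hx => by
    have hT := (hs.mem_T x).2 (h.lt_top x hx)
    exact ⟨hT, (hs.final x hT).b_eq_zero.2 hx⟩
  refine ⟨hmem _ h.evOK.source, ?_, ?_⟩
  · have hT := (hs.mem_T _).2 (h.lt_top _ h.evOK.source)
    cases hp : s.evaluatedTree.parent I.source with
    | none => rfl
    | some q => exact absurd (((hs.final _ hT).parent q).1 hp) (not_pred_source hω q)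
  · rintro x ⟨hxT, hx⟩
    rw [(hs.final x hxT).b_eq_zero] at hx
    obtain ⟨P, hP⟩ := exists_isShortestPath_of_dist_lt (h.lt_top x hx)
    have hPE : ∀ y ∈ P, y ∈ Ev := by
      intro y hy
      by_contra hyE
      exact not_reflTransGen_of_mem_ev h.evOK hyE hx (reflTransGen_of_mem hP hy)
    refine ⟨P, hag.isShortestPath hw (h.isShortestPath hP (h.near x hx)) fun e he => ?_,
      fun y hy => hmem y (hPE y hy), ?_⟩
    · exact h.known_of_ev e.1 e.2 (pred_of_mem_pathEdges hP he)
        (hPE _ (snd_mem_of_mem_pathEdges he))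
    · refine hP.isChain_pred.imp fun a b hab => ?_
      exact ((hs.final b ((hs.mem_T b).2 hab.2.2)).parent a).2 hab

/-! ### LRA* with infinite lookahead acts like LazySP -/

theorem Stable.shaped {s : LRAState V} (h : Stable I Ev E s) : Shaped I Ev E s :=
  ⟨h.mem_T, h.final⟩

theorem act_of_dist_eq_top (h : Reflects I known E Ev) {s : LRAState V} (hs : Stable I Ev E s)
    (ht : ¬ dist I (bandWeight I E) I.target < ∞) :
    s.act I = .report none ∧ lazySPAction I known = .report none := by
  constructor
  · have hQ : s.Qfrontier = ∅ := by
      refine Finset.eq_empty_of_forall_notMem fun x hx => ht ?_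
      obtain ⟨rfl, hx⟩ := (hs.front x).1 hx
      exact (hs.mem_T _).1 hx
    simp [act, hs.quiet.result, hQ]
  · refine lazySPAction_of_not_exists ?_
    rintro ⟨P, hP⟩
    refine ht (lt_of_le_of_lt ?_ hP.2.1)
    rcases h.dist_le_cost hP.1 with h' | h' <;> exact h'

theorem Stable.top_eq {s : LRAState V} (hs : Stable I Ev E s)
    (ht : dist I (bandWeight I E) I.target < ∞) : s.top I s.Qfrontier = I.target :=
  ((hs.front _).1 (top_mem ⟨I.target, (hs.front _).2 ⟨rfl, (hs.mem_T _).2 ht⟩⟩)).1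

theorem exists_nextEdge (h : Reflects I known E Ev) {s : LRAState V} (hs : Stable I Ev E s)
    (htE : I.target ∉ Ev) (ht : dist I (bandWeight I E) I.target < ∞) :
    ∃ P e A B, IsShortestPath I (bandWeight I E) I.target P ∧ s.nextEdge I = some e ∧
      s.act I = .eval e ∧ lazySPAction I known = .eval e ∧ P = A ++ e.1 :: e.2 :: B ∧
      e.1 ∈ Ev ∧ e.2 ∉ Ev := by
  obtain ⟨P, hP⟩ := exists_isShortestPath_of_dist_lt ht
  have hpath : s.pathTo (s.top I s.Qfrontier) = P := by
    rw [hs.top_eq ht]; exact hs.shaped.pathTo hP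
  have hcongr : ∀ f ∈ pathEdges P, decide ((s.node f.2).b ≠ 0) = (known f).isNone := by
    intro f hf
    have hpred := pred_of_mem_pathEdges hP hf
    have hk := h.known_iff hpred
    rw [Bool.eq_iff_iff]
    simp [(hs.final _ ((hs.mem_T _).2 hpred.2.2)).b_eq_zero, hk]
  have hfind : s.nextEdge I = (pathEdges P).find? (fun f => (known f).isNone) := by
    rw [nextEdge, hpath]
    exact List.find?_congr hcongr
  -- An unevaluated edge exists: the last edge of `P` leads to the target, which is not in `Ev`.
  obtain ⟨e, he⟩ : ∃ e, (pathEdges P).find? (fun f => (known f).isNone) = some e := by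
    rw [← Option.ne_none_iff_exists', Ne, List.find?_eq_none]
    intro hall
    obtain ⟨A, rfl⟩ := hP.1.exists_concat
    rcases List.eq_nil_or_concat A with rfl | ⟨A', p, rfl⟩
    · have := hP.1.2.1
      simp at this
      exact I.source_ne_target this.symm
    · have hP' : IsShortestPath I (bandWeight I E) I.target (A' ++ p :: I.target :: []) := by
        simpa using hP
      have hk := hall (p, I.target) (by
        rw [List.concat_eq_append, List.append_assoc, List.singleton_append, pathEdges_append_cons]
        simp)
      rw [Option.isNone_iff_eq_none] at hk
      exact hk ((h.known_iff hP'.pred).2 htE)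
  have hl := lazySPAction_of_isShortestPath h.weight (h.isShortestPath hP le_rfl)
  rw [he] at hl hfind
  obtain ⟨hke, A, B, hPe, hA⟩ := exists_split_of_find? he
  have hA' : ∀ f ∈ pathEdges (A ++ [e.1]), known f ≠ none := fun f hf =>
    Option.isSome_iff_ne_none.1 (by simpa using hA f hf)
  have hQ : s.Qfrontier ≠ ∅ :=
    Finset.nonempty_iff_ne_empty.1 ⟨I.target, (hs.front _).2 ⟨rfl, (hs.mem_T _).2 ht⟩⟩
  have hPe' := hP
  rw [hPe] at hPe'
  refine ⟨P, e, A, B, hP, hfind, by simp [act, hs.quiet.result, hQ, hfind], hl, hPe, ?_, ?_⟩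
  · rcases List.eq_nil_or_concat A with rfl | ⟨A', p, rfl⟩
    · have hsrc := hPe'.1.2.1
      simp at hsrc
      rw [hsrc]; exact h.evOK.source
    · rw [List.concat_eq_append, List.append_assoc] at hPe'
      have hp : Pred I (bandWeight I E) p e.1 := IsShortestPath.pred hPe'
      have hk := hA' (p, e.1) (by
        rw [List.concat_eq_append, List.append_assoc, List.singleton_append, pathEdges_append_cons]
        simp)
      by_contra hn
      exact hk ((h.known_iff hp).2 hn)
  · exact (h.known_iff hPe'.pred).1 (by simpa using hke)

/-- No vertex of `Ev` lies below `e.2`, so distances and predecessors within `Ev` do not change,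
while the distance of the target can only grow; this keeps `near`. -/
theorem Reflects.of_collision (h : Reflects I known E Ev) {e : V × V} (heE : e ∈ I.edges)
    (hev : e.2 ∉ Ev) : Reflects I (Function.update known e (some ∞)) (E.erase e) Ev := by
  have hdist : ∀ x ∈ Ev, dist I (bandWeight I (E.erase e)) x = dist I (bandWeight I E) x :=
    fun x hx => dist_erase (h.lt_top x hx) (not_reflTransGen_of_mem_ev h.evOK hev hx)
  refine ⟨fun f hf => ?_, (Finset.erase_subset _ _).trans h.sub, fun f hf => ?_,
    evOK_erase h.evOK h.lt_top hev, fun x hx => hdist x hx ▸ h.lt_top x hx, fun x hx => ?_,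
    fun p x hk hpx => ?_, fun p x hpx hx => ?_⟩
  · by_cases hfe : f = e
    · subst hfe; simp [currentWeight]
    · simpa [currentWeight, hfe] using h.weight f hf
  · by_cases hfe : f = e
    · subst hfe; simp
    · simpa [hfe] using h.mem_E f hf
  · rw [hdist x hx]
    exact (h.near x hx).trans (dist_mono (fun f _ => bandWeight_erase_le e f) _)
  · rw [Finset.mem_erase] at hpx
    rw [Function.update_of_ne hpx.1] at hk
    obtain ⟨hx, hp⟩ := h.tree p x hk hpx.2
    exact ⟨hx, pred_erase hp (not_reflTransGen_of_mem_ev h.evOK hev hx)⟩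
  · by_cases hfe : (p, x) = e
    · simp [hfe]
    · rw [Function.update_of_ne hfe]
      exact h.known_of_ev p x ((pred_erase_iff (h.lt_top x hx)
        (not_reflTransGen_of_mem_ev h.evOK hev hx)).1 hpx) hx

theorem currentWeight_update_free {e : V × V} (hk : known e = none) :
    currentWeight I (Function.update known e (some (I.lazyW e : ℝ≥0∞))) =
      currentWeight I known := by
  funext f
  by_cases hfe : f = e
  · subst hfe; simp [currentWeight, hk]
  · simp [currentWeight, hfe]

/-- The current weights do not change; only `e.2` joins `Ev`. It lies on the shortest path to the
target, which gives `near`. -/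
theorem Reflects.of_free (h : Reflects I known E Ev) {e : V × V} (hk : known e = none)
    (he : Pred I (bandWeight I E) e.1 e.2) (hev : e.1 ∈ Ev)
    (het : Relation.ReflTransGen (Pred I (bandWeight I E)) e.2 I.target) :
    Reflects I (Function.update known e (some (I.lazyW e : ℝ≥0∞))) E (insert e.2 Ev) := by
  have hω : IsWeight I (bandWeight I E) := isWeight_bandWeight E
  refine ⟨by rw [currentWeight_update_free hk]; exact h.weight, h.sub, fun f hf => ?_,
    ⟨Or.inr h.evOK.source, fun p x hpx hx => ?_⟩, fun x hx => ?_, fun x hx => ?_,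
    fun p x hkf hpx => ?_, fun p x hpx hx => ?_⟩
  · by_cases hfe : f = e
    · subst hfe
      simpa using he.mem_band.1
    · simpa [hfe] using h.mem_E f hf
  · rcases hx with rfl | hx
    · exact Or.inr (hpx.unique hω he ▸ hev)
    · exact Or.inr (h.evOK.closed p x hpx hx)
  · rcases hx with rfl | hx
    · exact he.2.2
    · exact h.lt_top x hx
  · rcases hx with rfl | hx
    · exact dist_le_of_reflTransGen het
    · exact h.near x hx
  · by_cases hfe : (p, x) = e
    · subst hfe
      exact ⟨Or.inl rfl, he⟩
    · rw [Function.update_of_ne hfe] at hkf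
      exact ⟨Or.inr (h.tree p x hkf hpx).1, (h.tree p x hkf hpx).2⟩
  · by_cases hfe : (p, x) = e
    · simp [hfe]
    · rw [Function.update_of_ne hfe]
      rcases hx with rfl | hx
      · exact absurd (congrArg (·, e.2) (hpx.unique hω he)) hfe
      · exact h.known_of_ev p x hpx hx

/-- The relation between the state of LRA* and the values recorded by LazySP. -/
def Related (I : Input V) (known : V × V → Option ℝ≥0∞) (s : LRAState V) : Prop :=
  ∃ E Ev, Reflects I known E Ev ∧ Shaped I Ev E s ∧
    ((I.target ∉ Ev ∧ Stable I Ev E s) ∨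
      ∃ P, s.result = some P ∧ lazySPAction I known = .report (some P))

theorem Related.act_eq {s : LRAState V} (h : Related I known s) :
    s.act I = lazySPAction I known := by
  obtain ⟨E, Ev, hR, -, ⟨htE, hs⟩ | ⟨P, h₁, h₂⟩⟩ := h
  · by_cases ht : dist I (bandWeight I E) I.target < ∞
    · obtain ⟨P, e, A, B, -, -, h₁, h₂, -⟩ := exists_nextEdge hR hs htE ht
      rw [h₁, h₂]
    · obtain ⟨h₁, h₂⟩ := act_of_dist_eq_top hR hs ht
      rw [h₁, h₂]
  · rw [h₂]; simp [act, h₁]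

theorem Related.fst_mem {s : LRAState V} (h : Related I known s) {e : V × V}
    (he : s.act I = .eval e) : e.1 ∈ s.evaluatedTree.verts := by
  obtain ⟨E, Ev, hR, -, ⟨htE, hs⟩ | ⟨P, h₁, h₂⟩⟩ := h
  · by_cases ht : dist I (bandWeight I E) I.target < ∞
    · obtain ⟨P, e', A, B, -, -, h₁, -, -, h₂, -⟩ := exists_nextEdge hR hs htE ht
      rw [h₁, Action.eval.injEq] at he
      subst he
      have hT := (hs.mem_T _).2 (hR.lt_top _ h₂)
      exact ⟨hT, (hs.final _ hT).b_eq_zero.2 h₂⟩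
    · rw [(act_of_dist_eq_top hR hs ht).1] at he
      simp at he
  · simp [act, h₁] at he

/-- Every iteration calls both the update and the rewiring; after a collision-free edge the latter
has nothing to do. -/
theorem rewireBand_of_quiet {s : LRAState V} (h₁ : s.Qrewire = ∅) (h₂ : s.Trewire = ∅) :
    rewireBand I ⊤ s = s := by
  have hnil : s.Trewire.toList.foldl (rewireReset I ⊤) s = s := by simp [h₂]
  simp only [rewireBand, hnil]
  rw [whileLoop_of_not (by simp [h₁])]
  cases s
  simp_all

/-- The entry of the head of an edge found to be collision-free. -/
theorem isFinal_evaluated {ω : V × V → ℝ≥0∞} (hω : IsWeight I ω) {e : V × V} (he : Pred I ω e.1 e.2)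
    {t : Entry V} (ht : IsFinal I ω Ev e.1 t) (h₁ : e.1 ∈ Ev) :
    IsFinal I ω (insert e.2 Ev) e.2 ⟨some e.1, t.c + I.lazyW e, 0, 0⟩ := by
  have hl := ht.l_eq_zero (ht.b_eq_zero.2 h₁)
  -- The tail of the edge is evaluated, so its `l` vanishes and `c` alone is its distance.
  have hc : t.c = dist I ω e.1 := by
    rw [← ht.key, Entry.key, hl, add_zero]
  refine ⟨fun p => ⟨fun hp => ?_, fun hp => ?_⟩, ?_, he.2.2, by simp, by simp, fun _ => rfl⟩
  · simp only [Option.some.injEq] at hp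
    exact hp ▸ he
  · simp [hp.unique hω he]
  · simp only [Entry.key, hc, add_zero]
    rw [he.2.1, hω.eq_lazyW he.1 he.weight_lt_top]

/-- `IsFinal` fixes only the sum of `c` and `l` and whether `b` vanishes, so descendants of a newly
evaluated vertex are final even before they are updated. -/
theorem isFinal_insert_of_ne {ω : V × V → ℝ≥0∞} {x y : V} {t : Entry V} (h : IsFinal I ω Ev x t)
    (hxy : x ≠ y) : IsFinal I ω (insert y Ev) x t :=
  ⟨h.parent, h.key, h.lt_top, h.b_ne_top, by simp [h.b_eq_zero, hxy], h.l_eq_zero⟩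

theorem Related.iteration {s : LRAState V} (h : Related I known s) {e : V × V}
    (he : s.act I = .eval e) (hwe : w e = I.lazyW e ∨ w e = ∞) :
    Related I (Function.update known e (some (w e))) (s.iteration I ⊤ (w e)) := by
  obtain ⟨E, Ev, hR, -, ⟨htE, hs⟩ | ⟨P, h₁, h₂⟩⟩ := h
  swap
  · simp [act, h₁] at he
  by_cases ht : dist I (bandWeight I E) I.target < ∞
  swap
  · rw [(act_of_dist_eq_top hR hs ht).1] at he
    simp at he
  have hω : IsWeight I (bandWeight I E) := isWeight_bandWeight E
  obtain ⟨P, e', A, B, hP, hnext, hact, -, hPe, h₁, h₂⟩ := exists_nextEdge hR hs htE ht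
  rw [hact, Action.eval.injEq] at he
  subst he
  have hPe' := hP
  rw [hPe] at hPe'
  have hpred : Pred I (bandWeight I E) e'.1 e'.2 := hPe'.pred
  have hk : known e' = none := (hR.known_iff hpred).2 h₂
  have het : Relation.ReflTransGen (Pred I (bandWeight I E)) e'.2 I.target :=
    reflTransGen_of_mem hPe' (by simp)
  have hQf : s.Qfrontier.erase (s.top I s.Qfrontier) = ∅ := by
    rw [hs.top_eq ht]
    refine Finset.eq_empty_of_forall_notMem fun x hx => ?_
    rw [Finset.mem_erase] at hx
    exact hx.1 ((hs.front x).1 hx.2).1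
  set s₁ : LRAState V := { s with Qfrontier := ∅ } with hs₁
  have hiter : s.iteration I ⊤ (w e') =
      if I.target ∈ (s₁.evaluate I e' (w e')).Qupdate then
        { s₁.evaluate I e' (w e') with
          result := some ((s₁.evaluate I e' (w e')).pathTo I.target) }
      else extendBand I ⊤ (rewireBand I ⊤ (updateBand I ⊤ (s₁.evaluate I e' (w e')))) := by
    simp only [LRAState.iteration, hnext, hQf]
    rfl
  by_cases hfree : w e' = I.lazyW e'
  · have hR' := hR.of_free hk hpred h₁ het
    rw [hfree] at hiter ⊢
    set s₂ := s₁.evaluate I e' (I.lazyW e') with hs₂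
    have heq : s₂ =
        { s₁ with
          node := Function.update s.node e'.2 ⟨some e'.1, (s.node e'.1).c + I.lazyW e', 0, 0⟩
          Qupdate := {e'.2} } := by
      simp [hs₂, evaluate, setNode, hs₁, hs.quiet.Qupdate]
    have hfin : ∀ x ∈ s.T, IsFinal I (bandWeight I E) (insert e'.2 Ev) x (s₂.node x) := by
      intro x hx
      rw [heq]
      by_cases hxe : x = e'.2
      · subst hxe
        simpa using isFinal_evaluated hω hpred
          (hs.final _ ((hs.mem_T _).2 hpred.dist_lt_top)) h₁
      · simpa [hxe] using isFinal_insert_of_ne (hs.final x hx) hxe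
    have hle : ∀ x, dist I (bandWeight I E) x ≤ (s₂.node x).key := by
      intro x
      by_cases hx : x ∈ s.T
      · exact (hfin x hx).key.ge
      · have hxe : x ≠ e'.2 := fun h => hx (h ▸ (hs.mem_T _).2 hpred.2.2)
        rw [heq]
        simpa [hxe] using hs.le_key x
    have hT : s₂.T = s.T := by rw [heq]
    have hshape : Shaped I (insert e'.2 Ev) E s₂ :=
      ⟨fun x => by rw [hT]; exact hs.mem_T x, fun x hx => hfin x (hT ▸ hx)⟩
    -- If the target has been reached, all edges of `P` are now evaluated, and LazySP reports the
    -- same path in its next action.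
    by_cases htgt : I.target = e'.2
    · rw [if_pos (by rw [heq]; simp [htgt])] at hiter
      rw [hiter]
      refine ⟨E, insert e'.2 Ev, hR', ⟨hshape.mem_T, hshape.final⟩, Or.inr ⟨P, ?_, ?_⟩⟩
      · simp [hshape.pathTo hP]
      · have hl := lazySPAction_of_isShortestPath hR'.weight (hR'.isShortestPath hP le_rfl)
        rw [hl]
        have hnone : (pathEdges P).find? (fun f => (Function.update known e'
            (some (I.lazyW e' : ℝ≥0∞)) f).isNone) = none := by
          rw [List.find?_eq_none]
          intro f hf
          have hf₁ := pred_of_mem_pathEdges hP hf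
          have hf₂ : f.2 ∈ insert e'.2 Ev := by
            by_contra hn
            exact not_reflTransGen_of_mem_ev hR'.evOK hn (Or.inl htgt)
              (reflTransGen_of_mem hP (snd_mem_of_mem_pathEdges hf))
          have := hR'.known_of_ev f.1 f.2 hf₁ hf₂
          simpa [Option.isNone_iff_eq_none] using this
        rw [hnone]
    · rw [if_neg (by rw [heq]; simpa using htgt)] at hiter
      rw [hiter]
      have hU : UpdInv I (insert e'.2 Ev) E s₂ := by
        refine ⟨?_, ?_, ?_, ?_, ?_, hshape.mem_T, hle, hshape.final, ?_, ?_,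
          fun q hq x hqx hx => ?_, ?_⟩
        · rw [heq]; exact hs.quiet.E_eq
        · rw [heq]; exact hs.quiet.result
        · rw [heq]; exact hs.quiet.Qrewire
        · rw [heq]; exact hs.quiet.Trewire
        · rw [heq]
        · rw [heq]; simpa [hs₁] using (hs.mem_T _).2 hpred.2.2
        · rw [heq]; simp [hs₁, hs.Qextend]
        · rw [heq] at hq
          rw [Finset.mem_singleton] at hq
          subst hq
          rcases hx with rfl | hx
          · exact lt_irrefl _ (hqx.dist_lt hω)
          · exact h₂ (hR.evOK.closed _ _ hqx hx)
        · rw [heq]; simp [hs₁, hs.Qextend]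
      have hX := extInv_updateBand hR'.evOK hR'.lt_top hU (y := e'.2) (by rw [heq]; simp) het
        I.source
      rw [rewireBand_of_quiet hX.quiet.Qrewire hX.quiet.Trewire]
      have hst := stable_extendBand hR.sub hR'.evOK hX
      exact ⟨E, _, hR', hst.shaped, Or.inl ⟨by simp [htgt, htE], hst⟩⟩
  -- In a collision the update queue is empty, so the target is not reported and the update loop
  -- does nothing.
  · have hinf := hwe.resolve_left hfree
    have hR' := hR.of_collision hpred.1 h₂
    have heq : s₁.evaluate I e' (w e') =
        { s with Qfrontier := ∅, E := E.erase e', Trewire := s.subtree e'.2 } := by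
      simp only [evaluate, if_neg hfree, hs₁, hs.quiet.E_eq]
      rfl
    rw [if_neg (by rw [heq]; simp [hs.quiet.Qupdate]), heq] at hiter
    have hupd : updateBand I ⊤
        { s with Qfrontier := ∅, E := E.erase e', Trewire := s.subtree e'.2 } =
        { s with Qfrontier := ∅, E := E.erase e', Trewire := s.subtree e'.2 } :=
      whileLoop_of_not (by simp [hs.quiet.Qupdate])
    rw [hiter, hupd, hinf]
    have hX := extInv_rewireBand hR.sub hR.evOK hR.lt_top hs h₂ het I.source
    have hst := stable_extendBand hR'.sub hR'.evOK hX
    exact ⟨_, _, hR', hst.shaped, Or.inl ⟨htE, hst⟩⟩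

theorem related_start : Related I (fun _ => none) (start I ⊤) := by
  have hst := stable_start (I := I)
  refine ⟨I.edges, {I.source}, ⟨fun e _ => Or.inl (by simp [currentWeight]), subset_rfl, ?_,
    evOK_singleton _, ?_, ?_, ?_, ?_⟩, hst.shaped, Or.inl ⟨?_, hst⟩⟩
  · intro e he; simpa using he
  · rintro x rfl; simp
  · rintro x rfl; simp
  · intro p x h; simp at h
  · rintro p x h rfl
    exact absurd h (not_pred_source (isWeight_bandWeight _) p)
  · exact I.source_ne_target.symm

end LRAState

/-! ### Simulation of LazySP by LRA* at every step -/

open LRAState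

variable {V : Type u} [Fintype V] [DecidableEq V]

theorem related_stateAt {I : Input V} {w : V × V → ℝ≥0∞} (hw : IsWeight I w) (n : ℕ) :
    Related I (lazySPKnown I w n) ((LRAstar V ⊤).stateAt I w n) := by
  induction n with
  | zero => exact related_start
  | succ n ih =>
    have hact := ih.act_eq
    rw [Algorithm.stateAt_succ, lazySPKnown_succ, ← hact]
    change Related I _ (match ((LRAstar V ⊤).stateAt I w n : LRAState V).act I with
      | .eval e => ((LRAstar V ⊤).stateAt I w n : LRAState V).iteration I ⊤ (w e)
      | .report _ => (LRAstar V ⊤).stateAt I w n)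
    cases h : ((LRAstar V ⊤).stateAt I w n : LRAState V).act I with
    | eval e => exact ih.iteration h (hw e (lazySPAction_eq_eval_edge (hact ▸ h)).1)
    | report r => exact ih

theorem LRAstar_action_eq {I : Input V} {w : V × V → ℝ≥0∞} (hw : IsWeight I w) (n : ℕ) :
    (LRAstar V ⊤).action I ((LRAstar V ⊤).stateAt I w n) = lazySPAction I (lazySPKnown I w n) :=
  (related_stateAt hw n).act_eq

theorem inSP_LRAstar : InSP (LRAstar V ⊤) := by
  refine ⟨fun _ s => evaluatedTree s, fun I w hw => ⟨fun n => ?_, fun n e he => ?_, ?_,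
    fun n P h => ?_, fun n h => ?_⟩⟩
  · obtain ⟨E, Ev, hR, hs, -⟩ := related_stateAt hw n
    exact isShortestPathTree_evaluatedTree hw (agrees_lazySPKnown n) hR hs
  · refine ⟨?_, (related_stateAt hw n).fst_mem he⟩
    rw [LRAstar_action_eq hw] at he
    exact (lazySPAction_eq_eval_edge he).1
  · obtain ⟨n, r, h⟩ := lazySP_terminates (I := I) (w := w)
    exact ⟨n, r, (LRAstar_action_eq hw n).trans h⟩
  · rw [LRAstar_action_eq hw] at h
    exact lazySP_report_some hw h
  · rw [LRAstar_action_eq hw] at h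
    exact lazySP_report_none hw h

end LazySearch

theorem mainTheorem1 (V : Type u) [Fintype V] [DecidableEq V] :
    LazySearch.EdgeOptimal (LazySearch.LRAstar V ⊤) ∧
    LazySearch.EdgeOptimal (LazySearch.lazySP V) := by
  exact ⟨LazySearch.edgeOptimal_of_action_eq LazySearch.inSP_LRAstar
      fun _ _ hw n => LazySearch.LRAstar_action_eq hw n,
    LazySearch.edgeOptimal_of_action_eq LazySearch.inSP_lazySP fun _ _ _ _ => rfl⟩
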